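/- Setting. Let $(X,\mu)$ be a probability space, $\xi:X\to\mathbb R^m$ measurable, and $\Theta_N=\{\sum_{i=1}^N\xi(\eta_i):\eta\in X^N\}$. For $\omega\in\Theta_N$ let $\nu_{N,\omega}$ be $\mu^N$ conditioned on $\sum_{i=1}^N\xi(\eta_i)=\omega$, that is: the $\nu_{N,\omega}$ are probability measures depending measurably on $\omega$, carried by this event, they form a regular conditional distribution of $\mu^N$ given $\sum_i\xi(\eta_i)$, and for every $N$, every $\omega\in\Theta_N$ and every set $A$ of indices, listed in any order, the conditional law under $\nu_{N,\omega}$ of $(\eta_j)_{j\in A}$ given $(\eta_i)_{i\notin A}$ is $\nu_{|A|,\,\omega-\sum_{i\notin A}\xi(\eta_i)}$. Fix $d\ge 1$ and let $\Lambda_N=\{1,\dots,N\}^d$, $\|x-y\|=\sum_k|x_k-y_k|$. On $X^{\Lambda_N}$ use the measure $\nu_{|\Lambda_N|,\omega}$, $\omega\in\Theta_{|\Lambda_N|}$. Generators. For a pair of indices $b$ let $D_bf=\nu[f\mid\mathcal F_b]-f$, where $\mathcal F_b$ is generated by the variables with index outside $b$, and on $L^2(\nu)$ let $$\mathcal L^*f=\frac1N\sum_{1\le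 i<j\le N}D_{\{i,j\}}f,\qquad \mathcal L^{*,loc}f=\sum_{\{x,y\}\subset\Lambda_N,\ \|x-y\|=1}D_{\{x,y\}}f .$$ For each $\omega\in\Theta_2$ let $\mathcal L_0=\mathcal L_0^\omega$ be a (possibly unbounded, densely defined) self-adjoint operator on $L^2(\nu_{2,\omega})$ with $-\mathcal L_0\ge0$ and $\mathcal L_0c=0$ for constants $c$. Put $\mathcal L_{i,j}f(\eta)=(\mathcal L_0^{\xi(\eta_i)+\xi(\eta_j)}f^{i,j}_\eta)(\eta_i,\eta_j)$, where $f^{i,j}_\eta(p,q)$ is $f(\eta)$ with $\eta_i,\eta_j$ replaced by $p,q$, and $$\mathcal Lf=\frac1N\sum_{1\le i<j\le N}\mathcal L_{i,j}f,\qquad \mathcal L^{loc}f=\sum_{\{x,y\}\subset\Lambda_N,\ \|x-y\|=1}\mathcal L_{x,y}f$$ (each pair $\{x,y\}$ being ordered so that $y=x+e_k$ for a coordinate direction $k$), with domain the $f\in L^2(\nu)$ such that, for every pair in the sum, $f^{i,j}_\eta\in\mathcal D(\mathcal L_0)$ for $\nu$-almost every $\eta$ and $\mathcal L_{i,j}f\in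 L^2(\nu)$. Spectral gaps. For $\mathcal G\in\{\mathcal L^*,\mathcal L^{*,loc},\mathcal L,\mathcal L^{loc}\}$ the spectral gap, denoted respectively $\lambda^*(N,\omega),\lambda^{*,loc}(N,\omega),\lambda(N,\omega),\lambda^{loc}(N,\omega)\in[0,+\infty]$, is the infimum of $\nu(f(-\mathcal G)f)/\nu(f^2)$ over $f\in\mathcal D(\mathcal G)$ with $\nu(f)=0$ and $\nu(f^2)\neq0$; it is $+\infty$ if $\nu$ is a Dirac mass. Theorem. Assume that the averaging process is ergodic for every $N\ge4$ and $\omega\in\Theta_N$: if $f\in L^2(\nu_{N,\omega})$ satisfies $\nu_{N,\omega}[f\mid\mathcal F_b]=f$ almost surely for all pairs $b$, then $f$ is almost surely constant. If $$\inf_{\omega\in\Theta_3}\lambda^*(3,\omega)>\tfrac13\quad\text{and}\quad\inf_{\omega\in\Theta_2}\lambda(2,\omega)>0,$$ then $$\inf_{N\ge2}\inf_{\omega\in\Theta_N}\lambda^*(N,\omega)>0,\qquad \inf_{N\ge2}\inf_{\omega\in\Theta_{|\Lambda_N|}}N^2\lambda^{*,loc}(N,\omega)>0,$$ $$\inf_{N\ge2}\inf_{\omega\in\Theta_N}\lambda(N,\omega)>0,\qquad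 \inf_{N\ge2}\inf_{\omega\in\Theta_{|\Lambda_N|}}N^2\lambda^{loc}(N,\omega)>0 .$$ -/

import Mathlib

open MeasureTheory ProbabilityTheory

namespace BinaryCollision

noncomputable section

/-! ### Product measures conditioned on a conservation law -/

/-- `Θ_N`: the values that `∑ i, ξ (η i)` takes on `X ^ N`. -/
def Theta {X : Type*} {m : ℕ} (ξ : X → Fin m → ℝ) (N : ℕ) : Set (Fin m → ℝ) :=
  Set.range fun η : Fin N → X => ∑ i, ξ (η i)

/-- `ν N ω` is the product measure `μ ^ N` conditioned on `∑ i, ξ (η i) = ω`: for `ω ∈ Θ_N` it is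
a probability measure carried by this event (`prob`, `support`), the family is a regular
conditional distribution of `μ ^ N` given `∑ i, ξ (η i)` (`disintegration`), and, for each set of
indices, listed in any order by an injection `e`, the variables with index in the range of `e`
have, given all the other variables `η i`, the law of the same family with the remaining value
`ω - ∑ ξ (η i)` of the conserved quantity (`conditional`). -/
structure IsConditionedProduct {X : Type*} [MeasurableSpace X] {m : ℕ} (μ : Measure X)
    (ξ : X → Fin m → ℝ) (ν : ∀ N : ℕ, Kernel (Fin m → ℝ) (Fin N → X)) : Prop where
  prob : ∀ N, ∀ ω ∈ Theta ξ N, IsProbabilityMeasure (ν N ω)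
  support : ∀ N, ∀ ω ∈ Theta ξ N, ∀ᵐ η ∂(ν N ω), ∑ i, ξ (η i) = ω
  disintegration : ∀ N, Measure.pi (fun _ : Fin N => μ) =
    ((Measure.pi fun _ : Fin N => μ).map fun η => ∑ i, ξ (η i)).bind (ν N)
  conditional : ∀ (N k : ℕ) (e : Fin k ↪ Fin N), ∀ ω ∈ Theta ξ N,
    ∀ S : Set (Fin N → X), MeasurableSet S →
      ν N ω S = ∫⁻ η, ν k (ω - ∑ i ∈ (Finset.univ.map e)ᶜ, ξ (η i))
        {ζ | Function.extend e ζ η ∈ S} ∂(ν N ω)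

/-- The conditioned measure on configurations on the cube `{1, …, N} ^ d`, whose sites are
numbered by `finFunctionFinEquiv`. -/
def cubeLaw {X : Type*} [MeasurableSpace X] {m : ℕ}
    (ν : ∀ N : ℕ, Kernel (Fin m → ℝ) (Fin N → X)) (d N : ℕ) (ω : Fin m → ℝ) :
    Measure ((Fin d → Fin N) → X) :=
  (ν (N ^ d) ω).map fun η x => η (finFunctionFinEquiv x)

/-! ### Pairs of sites -/

/-- All unordered pairs in `{1, …, N}`, each listed once, as `(i, j)` with `i < j`. -/
def completePairs (N : ℕ) : Finset (Fin N × Fin N) :=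
  Finset.univ.filter fun p => p.1 < p.2

open Classical in
/-- All unordered pairs of sites of the cube at `ℓ¹` distance one, each listed once, as `(x, y)`
with `y = x + e_k` for a coordinate direction `k`. -/
def cubePairs (d N : ℕ) : Finset ((Fin d → Fin N) × (Fin d → Fin N)) :=
  Finset.univ.filter fun p =>
    p.1 ≤ p.2 ∧ ∑ k, |((p.1 k : ℕ) : ℤ) - ((p.2 k : ℕ) : ℤ)| = 1

/-! ### Spectral gaps -/

/-- The infimum of `P (f (-L) f) / P (f ^ 2)` over the `f ≠ 0` in the domain of `L` with
`P f = 0`, where `L f = g` is expressed by the relation `G f g`. The infimum over the empty set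
is `⊤`, so the value is `+∞` if `P` is a Dirac measure. -/
def gap {Ω : Type*} [MeasurableSpace Ω] (P : Measure Ω) (G : (Ω → ℝ) → (Ω → ℝ) → Prop) : EReal :=
  ⨅ (f : Ω → ℝ) (g : Ω → ℝ) (_ : MemLp f 2 P) (_ : G f g)
    (_ : ∫ η, f η ∂P = 0) (_ : ∫ η, f η ^ 2 ∂P ≠ 0),
    (((∫ η, f η * (-g η) ∂P) / ∫ η, f η ^ 2 ∂P : ℝ) : EReal)

/-- The σ-algebra generated by the variables `η k` with `k ≠ i, j`. -/
abbrev outsideSigma {ι X : Type*} [MeasurableSpace X] (i j : ι) : MeasurableSpace (ι → X) :=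
  MeasurableSpace.comap (fun (η : ι → X) (k : {k : ι // k ≠ i ∧ k ≠ j}) => η k) inferInstance

/-- `g = c * ∑ b ∈ B, (P[f | F_b] - f)`: the generator of the process given by simple averages,
defined on all of `L²(P)`. -/
def IsAverageGen {ι X : Type*} [MeasurableSpace X] (P : Measure (ι → X)) (B : Finset (ι × ι))
    (c : ℝ) (f g : (ι → X) → ℝ) : Prop :=
  g = fun η => c * ∑ b ∈ B, ((P[f | outsideSigma b.1 b.2]) η - f η)

/-- The function `f^{i,j}_η` of two variables: `f` with `η i`, `η j` replaced by the arguments. -/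
def slice {ι X : Type*} [DecidableEq ι] (i j : ι) (η : ι → X) (f : (ι → X) → ℝ) :
    (Fin 2 → X) → ℝ :=
  fun ζ => f (Function.update (Function.update η i (ζ 0)) j (ζ 1))

/-- For every `ω ∈ Θ_2`, the operator `L₀ ω` on `L²(ν_{2,ω})` is a (possibly unbounded, densely
defined) self-adjoint operator, `-L₀ ω` is nonnegative, and `L₀ ω` vanishes on constants. -/
structure IsTwoSiteGenerator {X : Type*} [MeasurableSpace X] {m : ℕ} (ξ : X → Fin m → ℝ)
    (ν : ∀ N : ℕ, Kernel (Fin m → ℝ) (Fin N → X))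
    (L₀ : ∀ ω : Fin m → ℝ, Lp ℝ 2 (ν 2 ω) →ₗ.[ℝ] Lp ℝ 2 (ν 2 ω)) : Prop where
  dense : ∀ ω ∈ Theta ξ 2, Dense ((L₀ ω).domain : Set (Lp ℝ 2 (ν 2 ω)))
  selfAdjoint : ∀ ω ∈ Theta ξ 2, IsSelfAdjoint (L₀ ω)
  nonneg : ∀ ω ∈ Theta ξ 2, ∀ u : (L₀ ω).domain,
    0 ≤ inner ℝ (u : Lp ℝ 2 (ν 2 ω)) (-(L₀ ω u))
  const : ∀ ω ∈ Theta ξ 2, ∀ (u : Lp ℝ 2 (ν 2 ω)) (a : ℝ), (u =ᵐ[ν 2 ω] fun _ => a) →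
    ∃ hu : u ∈ (L₀ ω).domain, L₀ ω ⟨u, hu⟩ = 0

/-- `h = L_{i,j} f`, that is, `h η = (L₀^{ξ(η_i) + ξ(η_j)} f^{i,j}_η) (η_i, η_j)`: for almost every
`η`, the function `f^{i,j}_η` is in the domain of `L₀` and `L₀` maps it to `h^{i,j}_η`. -/
def IsPairGen {ι X : Type*} [DecidableEq ι] [MeasurableSpace X] {m : ℕ} (ξ : X → Fin m → ℝ)
    (ν : ∀ N : ℕ, Kernel (Fin m → ℝ) (Fin N → X))
    (L₀ : ∀ ω : Fin m → ℝ, Lp ℝ 2 (ν 2 ω) →ₗ.[ℝ] Lp ℝ 2 (ν 2 ω))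
    (P : Measure (ι → X)) (i j : ι) (f h : (ι → X) → ℝ) : Prop :=
  ∀ᵐ η ∂P, ∃ u : (L₀ (ξ (η i) + ξ (η j))).domain,
    ((u : Lp ℝ 2 (ν 2 (ξ (η i) + ξ (η j)))) =ᵐ[ν 2 (ξ (η i) + ξ (η j))] slice i j η f) ∧
    (L₀ (ξ (η i) + ξ (η j)) u =ᵐ[ν 2 (ξ (η i) + ξ (η j))] slice i j η h)

/-- `g = L f`, where `L = c * ∑ b ∈ B, L_b` is defined on the `f` for which every `L_b f` is
defined and lies in `L²(P)`. -/
def IsCollisionGen {ι X : Type*} [DecidableEq ι] [MeasurableSpace X] {m : ℕ}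
    (ξ : X → Fin m → ℝ) (ν : ∀ N : ℕ, Kernel (Fin m → ℝ) (Fin N → X))
    (L₀ : ∀ ω : Fin m → ℝ, Lp ℝ 2 (ν 2 ω) →ₗ.[ℝ] Lp ℝ 2 (ν 2 ω))
    (P : Measure (ι → X)) (B : Finset (ι × ι)) (c : ℝ) (f g : (ι → X) → ℝ) : Prop :=
  ∃ h : ι × ι → (ι → X) → ℝ,
    (∀ b ∈ B, MemLp (h b) 2 P ∧ IsPairGen ξ ν L₀ P b.1 b.2 f (h b)) ∧
    g = fun η => c * ∑ b ∈ B, h b η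

/-- `λ^*(N, ω)`. -/
def gapAvg {X : Type*} [MeasurableSpace X] {m : ℕ}
    (ν : ∀ N : ℕ, Kernel (Fin m → ℝ) (Fin N → X)) (N : ℕ) (ω : Fin m → ℝ) : EReal :=
  gap (ν N ω) (IsAverageGen (ν N ω) (completePairs N) (1 / (N : ℝ)))

/-- `λ^{*,loc}(N, ω)` on the `d`-dimensional cube. -/
def gapAvgLoc {X : Type*} [MeasurableSpace X] {m : ℕ}
    (ν : ∀ N : ℕ, Kernel (Fin m → ℝ) (Fin N → X)) (d N : ℕ) (ω : Fin m → ℝ) : EReal :=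
  gap (cubeLaw ν d N ω) (IsAverageGen (cubeLaw ν d N ω) (cubePairs d N) 1)

/-- `λ(N, ω)`. -/
def gapColl {X : Type*} [MeasurableSpace X] {m : ℕ} (ξ : X → Fin m → ℝ)
    (ν : ∀ N : ℕ, Kernel (Fin m → ℝ) (Fin N → X))
    (L₀ : ∀ ω : Fin m → ℝ, Lp ℝ 2 (ν 2 ω) →ₗ.[ℝ] Lp ℝ 2 (ν 2 ω))
    (N : ℕ) (ω : Fin m → ℝ) : EReal :=
  gap (ν N ω) (IsCollisionGen ξ ν L₀ (ν N ω) (completePairs N) (1 / (N : ℝ)))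

/-- `λ^{loc}(N, ω)` on the `d`-dimensional cube. -/
def gapCollLoc {X : Type*} [MeasurableSpace X] {m : ℕ} (ξ : X → Fin m → ℝ)
    (ν : ∀ N : ℕ, Kernel (Fin m → ℝ) (Fin N → X))
    (L₀ : ∀ ω : Fin m → ℝ, Lp ℝ 2 (ν 2 ω) →ₗ.[ℝ] Lp ℝ 2 (ν 2 ω))
    (d N : ℕ) (ω : Fin m → ℝ) : EReal :=
  gap (cubeLaw ν d N ω) (IsCollisionGen ξ ν L₀ (cubeLaw ν d N ω) (cubePairs d N) 1)

/-- The averaging process with `N` components is ergodic under `ν_{N,ω}`: the functions in `L²`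
that are fixed by all pair averages (the kernel of the generator) are the constants. -/
def IsErgodicAvg {X : Type*} [MeasurableSpace X] {m : ℕ}
    (ν : ∀ N : ℕ, Kernel (Fin m → ℝ) (Fin N → X)) (N : ℕ) (ω : Fin m → ℝ) : Prop :=
  ∀ f : (Fin N → X) → ℝ, MemLp f 2 (ν N ω) →
    (∀ i j : Fin N, i < j → (ν N ω)[f | outsideSigma i j] =ᵐ[ν N ω] f) →
    ∃ a : ℝ, f =ᵐ[ν N ω] fun _ => a

end

end BinaryCollision

/-!
The conditional expectation given the variables outside a pair `b` is the average `E_b` over the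
two variables of `b` with respect to `ν 2` (`IsGibbs.condExp_ae_eq`). The proof uses the measures
`ν N ω` only through the invariance under such resamplings (`IsGibbs`), a property which passes
to the cube by relabelling the sites.

*Complete graph.* Let `A = ∑_b (1 - E_b)`. In the expansion of `‖A f‖²` the disjoint pairs
contribute nonnegative terms, since their averages commute (`IsGibbs.blockAvg_comm`), so that
their product is a projection. The pairs with a common site are collected into triples of sites.
Conditionally on the other variables a triple is the process with three sites, whose gap `κ / 3`
gives `A_T² ≥ κ A_T` for the sum `A_T` over the three pairs of the triple
(`IsGibbs.norm_sq_triple_ge`). Summation over all triples (`norm_sq_sum_pairs_ge`) yields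
`A² ≥ (1 + (κ - 1) (N - 2)) A`, and as the kernel of `A` consists of the constants, this is a lower
bound of order `N` for `A` on functions of mean zero
(`mul_norm_sq_le_inner_of_mul_inner_le_norm_sq`, `mul_norm_sq_le_sum_completePairs`). Here `κ > 1`
is what makes the bound grow linearly in `N`.

*Nearest neighbours.* The measure is invariant under the exchange of two variables, and the
exchange of `x` and `y` moves `f` by at most `2 ‖f - E_{xy} f‖`. Hence
`‖f - E_{xz} f‖ ≤ 2 ‖f - E_{xy} f‖ + ‖f - E_{yz} f‖` (`IsGibbs.pairDist_triangle`). Summing this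
along lattice paths compares the complete graph on the cube with the nearest-neighbour graph, at
the price of a factor `N ^ (d + 2)` (`sum_sum_sq_le_sum_cubePairs`).

*Collisions.* The gap for two sites, applied conditionally on the other variables, bounds the
Dirichlet form of `L_b` from below by a multiple of `‖f - E_b f‖²`
(`IsGibbs.two_mul_norm_sub_pairProj_sq_le`), which reduces the collision processes to the
averaging processes.
-/

namespace BinaryCollision

noncomputable section

/-! ### Resampling a block of variables -/

section Resampling

variable {X : Type*} {m : ℕ} {ι : Type*} {k : ℕ}

/-- The sum of the conserved quantity over the block of variables listed by `e`. -/
def blockSum (ξ : X → Fin m → ℝ) (e : Fin k ↪ ι) (η : ι → X) : Fin m → ℝ :=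
  ∑ a, ξ (η (e a))

theorem blockSum_mem_Theta (ξ : X → Fin m → ℝ) (e : Fin k ↪ ι) (η : ι → X) :
    blockSum ξ e η ∈ Theta ξ k :=
  ⟨fun a => η (e a), rfl⟩

theorem blockSum_extend (ξ : X → Fin m → ℝ) (e : Fin k ↪ ι) (η : ι → X) (ζ : Fin k → X) :
    blockSum ξ e (Function.extend e ζ η) = ∑ a, ξ (ζ a) := by
  simp [blockSum, e.injective.extend_apply]

theorem extend_extend (e : Fin k ↪ ι) (η : ι → X) (ζ ζ' : Fin k → X) :
    Function.extend e ζ' (Function.extend e ζ η) = Function.extend e ζ' η := by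
  funext i
  by_cases h : ∃ a, e a = i
  · obtain ⟨a, rfl⟩ := h
    simp [e.injective.extend_apply]
  · simp [Function.extend_apply' _ _ _ h]

theorem sum_compl_add_blockSum [Fintype ι] [DecidableEq ι] (ξ : X → Fin m → ℝ) (e : Fin k ↪ ι)
    (η : ι → X) :
    ∑ i ∈ (Finset.univ.map e)ᶜ, ξ (η i) + blockSum ξ e η = ∑ i, ξ (η i) := by
  rw [← Finset.sum_compl_add_sum (Finset.univ.map e), Finset.sum_map, blockSum]

variable [MeasurableSpace X]

theorem measurable_blockSum {ξ : X → Fin m → ℝ} (hξ : Measurable ξ) (e : Fin k ↪ ι) :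
    Measurable (blockSum ξ e) := by
  unfold blockSum
  fun_prop

theorem measurable_extend (e : Fin k ↪ ι) :
    Measurable fun p : (ι → X) × (Fin k → X) => Function.extend e p.2 p.1 := by
  refine measurable_pi_iff.2 fun i => ?_
  by_cases h : ∃ a, e a = i
  · obtain ⟨a, rfl⟩ := h
    simp only [e.injective.extend_apply]
    fun_prop
  · simp only [Function.extend_apply' _ _ _ h]
    fun_prop

theorem measurable_extend_right (e : Fin k ↪ ι) (η : ι → X) :
    Measurable fun ζ : Fin k → X => Function.extend e ζ η :=
  (measurable_extend e).comp (measurable_const.prodMk measurable_id)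

theorem measurableSet_measure_univ_eq_one
    (ν : ∀ N : ℕ, Kernel (Fin m → ℝ) (Fin N → X)) (k : ℕ) :
    MeasurableSet {ω | ν k ω Set.univ = 1} :=
  (Kernel.measurable_coe (ν k) MeasurableSet.univ) (measurableSet_singleton 1)

open Classical in
/-- The kernel `ν k`, replaced by zero where it is not a probability measure. This makes it a
finite kernel without changing it on `Theta ξ k`. -/
def probPart (ν : ∀ N : ℕ, Kernel (Fin m → ℝ) (Fin N → X)) (k : ℕ) :
    Kernel (Fin m → ℝ) (Fin k → X) :=
  Kernel.piecewise (measurableSet_measure_univ_eq_one ν k) (ν k) 0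

instance isFiniteKernel_probPart (ν : ∀ N : ℕ, Kernel (Fin m → ℝ) (Fin N → X)) (k : ℕ) :
    IsFiniteKernel (probPart ν k) := by
  refine ⟨1, by simp, fun ω => ?_⟩
  classical
  rw [probPart, Kernel.piecewise_apply]
  split_ifs with h
  · exact le_of_eq h
  · simp

theorem probPart_apply (ν : ∀ N : ℕ, Kernel (Fin m → ℝ) (Fin N → X)) (k : ℕ) (ω : Fin m → ℝ)
    [h : IsProbabilityMeasure (ν k ω)] : probPart ν k ω = ν k ω := by
  classical
  rw [probPart, Kernel.piecewise_apply]
  simp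

/-- The kernel that replaces the variables listed by `e` by a sample of `ν k (s η)`. -/
def refresh (ν : ∀ N : ℕ, Kernel (Fin m → ℝ) (Fin N → X)) (e : Fin k ↪ ι)
    (s : (ι → X) → Fin m → ℝ) (hs : Measurable s) : Kernel (ι → X) (ι → X) :=
  (Kernel.id ×ₖ (probPart ν k).comap s hs).map fun p => Function.extend e p.2 p.1

instance isFiniteKernel_refresh (ν : ∀ N : ℕ, Kernel (Fin m → ℝ) (Fin N → X)) (e : Fin k ↪ ι)
    (s : (ι → X) → Fin m → ℝ) (hs : Measurable s) : IsFiniteKernel (refresh ν e s hs) := by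
  unfold refresh
  infer_instance

theorem refresh_apply (ν : ∀ N : ℕ, Kernel (Fin m → ℝ) (Fin N → X)) (e : Fin k ↪ ι)
    (s : (ι → X) → Fin m → ℝ) (hs : Measurable s) (η : ι → X) :
    refresh ν e s hs η = (probPart ν k (s η)).map fun ζ => Function.extend e ζ η := by
  rw [refresh, Kernel.map_apply _ (measurable_extend e), Kernel.prod_apply, Kernel.id_apply,
    Kernel.comap_apply, Measure.dirac_prod, Measure.map_map (measurable_extend e) (by fun_prop)]
  rfl

/-- The kernel that resamples the variables listed by `e` conditionally on all the others: they
are replaced by a sample of `ν k` with the same value of the conserved quantity. -/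
def resample {ξ : X → Fin m → ℝ} (hξ : Measurable ξ)
    (ν : ∀ N : ℕ, Kernel (Fin m → ℝ) (Fin N → X)) (e : Fin k ↪ ι) : Kernel (ι → X) (ι → X) :=
  refresh ν e (blockSum ξ e) (measurable_blockSum hξ e)

instance isFiniteKernel_resample {ξ : X → Fin m → ℝ} (hξ : Measurable ξ)
    (ν : ∀ N : ℕ, Kernel (Fin m → ℝ) (Fin N → X)) (e : Fin k ↪ ι) :
    IsFiniteKernel (resample hξ ν e) := by
  unfold resample
  infer_instance

/-- The average of `f` over the variables listed by `e`, given all the others. -/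
def blockAvg (ξ : X → Fin m → ℝ) (ν : ∀ N : ℕ, Kernel (Fin m → ℝ) (Fin N → X)) (e : Fin k ↪ ι)
    (f : (ι → X) → ℝ) (η : ι → X) : ℝ :=
  ∫ ζ, f (Function.extend e ζ η) ∂(ν k (blockSum ξ e η))

variable {μ : Measure X} {ξ : X → Fin m → ℝ} (hξ : Measurable ξ)
  {ν : ∀ N : ℕ, Kernel (Fin m → ℝ) (Fin N → X)}

theorem IsConditionedProduct.isProbabilityMeasure_blockSum (hν : IsConditionedProduct μ ξ ν)
    (e : Fin k ↪ ι) (η : ι → X) : IsProbabilityMeasure (ν k (blockSum ξ e η)) :=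
  hν.prob k _ (blockSum_mem_Theta ξ e η)

theorem resample_apply (hν : IsConditionedProduct μ ξ ν) (e : Fin k ↪ ι) (η : ι → X) :
    resample hξ ν e η = (ν k (blockSum ξ e η)).map fun ζ => Function.extend e ζ η := by
  have := hν.isProbabilityMeasure_blockSum e η
  rw [resample, refresh_apply, probPart_apply]

theorem lintegral_resample (hν : IsConditionedProduct μ ξ ν) (e : Fin k ↪ ι) (η : ι → X)
    {f : (ι → X) → ENNReal} (hf : Measurable f) :
    ∫⁻ θ, f θ ∂(resample hξ ν e η) =
      ∫⁻ ζ, f (Function.extend e ζ η) ∂(ν k (blockSum ξ e η)) := by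
  rw [resample_apply hξ hν, lintegral_map hf (measurable_extend_right e η)]

theorem integral_resample (hν : IsConditionedProduct μ ξ ν) (e : Fin k ↪ ι) (η : ι → X)
    {f : (ι → X) → ℝ} (hf : Measurable f) :
    ∫ θ, f θ ∂(resample hξ ν e η) = blockAvg ξ ν e f η := by
  rw [resample_apply hξ hν, integral_map (measurable_extend_right e η).aemeasurable
    hf.aestronglyMeasurable, blockAvg]

theorem integrable_resample_iff (hν : IsConditionedProduct μ ξ ν) (e : Fin k ↪ ι) (η : ι → X)
    {f : (ι → X) → ℝ} (hf : Measurable f) :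
    Integrable f (resample hξ ν e η) ↔
      Integrable (fun ζ => f (Function.extend e ζ η)) (ν k (blockSum ξ e η)) := by
  rw [resample_apply hξ hν, integrable_map_measure hf.aestronglyMeasurable
    (measurable_extend_right e η).aemeasurable]
  rfl

theorem measurable_blockAvg (hξ : Measurable ξ) (hν : IsConditionedProduct μ ξ ν) (e : Fin k ↪ ι)
    {f : (ι → X) → ℝ} (hf : Measurable f) : Measurable (blockAvg ξ ν e f) := by
  have : blockAvg ξ ν e f = fun η => ∫ θ, f θ ∂(resample hξ ν e η) :=
    funext fun η => (integral_resample hξ hν e η hf).symm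
  rw [this]
  exact hf.stronglyMeasurable.integral_kernel.measurable

/-- Averages over a block do not depend on the variables in the block, except through the
conserved quantity. -/
theorem blockAvg_extend (e : Fin k ↪ ι) (f : (ι → X) → ℝ) (η : ι → X)
    {ζ : Fin k → X} (h : ∑ a, ξ (ζ a) = blockSum ξ e η) :
    blockAvg ξ ν e f (Function.extend e ζ η) = blockAvg ξ ν e f η := by
  simp only [blockAvg, blockSum_extend, extend_extend, h]

theorem ae_sum_eq_blockSum (hν : IsConditionedProduct μ ξ ν) (e : Fin k ↪ ι) (η : ι → X) :
    ∀ᵐ ζ ∂(ν k (blockSum ξ e η)), ∑ a, ξ (ζ a) = blockSum ξ e η :=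
  hν.support k _ (blockSum_mem_Theta ξ e η)

end Resampling

/-! ### Measures invariant under resampling -/

section Gibbs

variable {X : Type*} [MeasurableSpace X] {m : ℕ} {ι : Type*} [Fintype ι] {k : ℕ}

/-- `P` is a canonical Gibbs measure for `ν`: the total conserved quantity is `ω`, and the
resampling of any block of variables leaves `P` invariant. -/
structure IsGibbs {ξ : X → Fin m → ℝ} (hξ : Measurable ξ)
    (ν : ∀ N : ℕ, Kernel (Fin m → ℝ) (Fin N → X)) (P : Measure (ι → X)) (ω : Fin m → ℝ) :
    Prop where
  prob : IsProbabilityMeasure P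
  sum_eq : ∀ᵐ η ∂P, ∑ i, ξ (η i) = ω
  invariant : ∀ (k : ℕ) (e : Fin k ↪ ι), P.bind (resample hξ ν e) = P

variable {μ : Measure X} {ξ : X → Fin m → ℝ} {hξ : Measurable ξ}
  {ν : ∀ N : ℕ, Kernel (Fin m → ℝ) (Fin N → X)} {P : Measure (ι → X)} {ω : Fin m → ℝ}

theorem IsConditionedProduct.isGibbs (hν : IsConditionedProduct μ ξ ν) (hξ : Measurable ξ) (N : ℕ)
    (hω : ω ∈ Theta ξ N) : IsGibbs hξ ν (ν N ω) ω := by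
  refine ⟨hν.prob N ω hω, hν.support N ω hω, fun k e => ?_⟩
  ext S hS
  rw [Measure.bind_apply hS (Kernel.aemeasurable _), hν.conditional N k e ω hω S hS]
  refine lintegral_congr_ae ?_
  filter_upwards [hν.support N ω hω] with η hη
  rw [resample_apply hξ hν, Measure.map_apply (measurable_extend_right e η) hS, ← hη,
    ← sum_compl_add_blockSum ξ e η, add_sub_cancel_left]
  rfl

theorem IsGibbs.lintegral_eq (hP : IsGibbs hξ ν P ω) (hν : IsConditionedProduct μ ξ ν)
    (e : Fin k ↪ ι) {f : (ι → X) → ENNReal} (hf : Measurable f) :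
    ∫⁻ η, ∫⁻ ζ, f (Function.extend e ζ η) ∂(ν k (blockSum ξ e η)) ∂P = ∫⁻ η, f η ∂P := by
  conv_rhs => rw [← hP.invariant k e]
  rw [Measure.lintegral_bind (Kernel.aemeasurable _) hf.aemeasurable]
  simp_rw [lintegral_resample hξ hν e _ hf]

theorem IsGibbs.ae_ae (hP : IsGibbs hξ ν P ω) (hν : IsConditionedProduct μ ξ ν)
    (e : Fin k ↪ ι) {p : (ι → X) → Prop} (hp : ∀ᵐ η ∂P, p η) :
    ∀ᵐ η ∂P, ∀ᵐ ζ ∂(ν k (blockSum ξ e η)), p (Function.extend e ζ η) := by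
  rw [← hP.invariant k e] at hp
  filter_upwards [Measure.ae_ae_of_ae_comp hp] with η hη
  rw [resample_apply hξ hν] at hη
  exact ae_of_ae_map (measurable_extend_right e η).aemeasurable hη

theorem IsGibbs.integral_eq (hP : IsGibbs hξ ν P ω) (hν : IsConditionedProduct μ ξ ν)
    (e : Fin k ↪ ι) {f : (ι → X) → ℝ} (hf : Measurable f) (hfi : Integrable f P) :
    ∫ η, blockAvg ξ ν e f η ∂P = ∫ η, f η ∂P := by
  conv_rhs => rw [← hP.invariant k e]
  rw [← hP.invariant k e] at hfi
  rw [Measure.comp_eq_comp_const_apply] at hfi ⊢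
  rw [Kernel.integral_comp hfi]
  simp_rw [integral_resample hξ hν e _ hf, Kernel.const_apply]

theorem IsGibbs.ae_integrable (hP : IsGibbs hξ ν P ω) (hν : IsConditionedProduct μ ξ ν)
    (e : Fin k ↪ ι) {f : (ι → X) → ℝ} (hf : Measurable f) (hfi : Integrable f P) :
    ∀ᵐ η ∂P, Integrable (fun ζ => f (Function.extend e ζ η)) (ν k (blockSum ξ e η)) := by
  rw [← hP.invariant k e] at hfi
  filter_upwards [Measure.ae_integrable_of_integrable_comp hfi] with η hη
  exact (integrable_resample_iff hξ hν e η hf).1 hη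

theorem IsGibbs.integrable_blockAvg (hP : IsGibbs hξ ν P ω) (hν : IsConditionedProduct μ ξ ν)
    (e : Fin k ↪ ι) {f : (ι → X) → ℝ} (hf : Measurable f) (hfi : Integrable f P) :
    Integrable (blockAvg ξ ν e f) P := by
  rw [← hP.invariant k e] at hfi
  have := Measure.integrable_integral_norm_of_integrable_comp hfi
  refine this.mono (measurable_blockAvg hξ hν e hf).aestronglyMeasurable (ae_of_all _ fun η => ?_)
  rw [← integral_resample hξ hν e η hf]
  exact (norm_integral_le_integral_norm _).trans (le_abs_self _)

theorem IsGibbs.ae_memLp (hP : IsGibbs hξ ν P ω) (hν : IsConditionedProduct μ ξ ν)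
    (e : Fin k ↪ ι) {f : (ι → X) → ℝ} (hf : Measurable f) (hfi : MemLp f 2 P) :
    ∀ᵐ η ∂P, MemLp (fun ζ => f (Function.extend e ζ η)) 2 (ν k (blockSum ξ e η)) := by
  filter_upwards [hP.ae_integrable hν e (hf.pow_const 2) hfi.integrable_sq] with η hη
  exact (memLp_two_iff_integrable_sq
    (hf.comp (measurable_extend_right e η)).aestronglyMeasurable).2 hη

theorem IsGibbs.blockAvg_congr (hP : IsGibbs hξ ν P ω) (hν : IsConditionedProduct μ ξ ν)
    (e : Fin k ↪ ι) {f g : (ι → X) → ℝ} (h : f =ᵐ[P] g) :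
    blockAvg ξ ν e f =ᵐ[P] blockAvg ξ ν e g := by
  filter_upwards [hP.ae_ae hν e h] with η hη
  exact integral_congr_ae hη

end Gibbs

/-! ### Symmetry and relabelling -/

section Relabelling

variable {X : Type*} {m : ℕ} {ι ι' : Type*} {k l : ℕ}

theorem extend_comp_equiv (τ : ι' ≃ ι) (e : Fin k ↪ ι) (ζ : Fin k → X) (η : ι → X) :
    Function.extend e ζ η ∘ τ =
      Function.extend (e.trans τ.symm.toEmbedding) ζ (η ∘ τ) := by
  funext i
  by_cases h : ∃ a, e a = τ i
  · obtain ⟨a, ha⟩ := h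
    have : i = e.trans τ.symm.toEmbedding a := by simp [ha]
    rw [this, (Function.Embedding.injective _).extend_apply]
    simp [e.injective.extend_apply]
  · have h' : ¬ ∃ a, e.trans τ.symm.toEmbedding a = i := by
      rintro ⟨a, rfl⟩
      exact h ⟨a, by simp⟩
    simp [Function.extend_apply' _ _ _ h, Function.extend_apply' _ _ _ h', Function.comp]

theorem extend_trans_perm (σ : Equiv.Perm (Fin k)) (e : Fin k ↪ ι) (ζ : Fin k → X) (η : ι → X) :
    Function.extend (σ.toEmbedding.trans e) ζ η = Function.extend e (ζ ∘ σ.symm) η := by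
  funext i
  by_cases h : ∃ a, e a = i
  · obtain ⟨a, rfl⟩ := h
    have : e a = σ.toEmbedding.trans e (σ.symm a) := by simp
    rw [e.injective.extend_apply, this, (Function.Embedding.injective _).extend_apply]
    rfl
  · have h' : ¬ ∃ a, σ.toEmbedding.trans e a = i := by
      rintro ⟨a, rfl⟩
      exact h ⟨σ a, rfl⟩
    rw [Function.extend_apply' _ _ _ h, Function.extend_apply' _ _ _ h']

theorem extend_congr (e : Fin k ↪ ι) (ζ : Fin k → X) {η η' : ι → X}
    (h : ∀ i, (¬ ∃ a, e a = i) → η i = η' i) :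
    Function.extend e ζ η = Function.extend e ζ η' := by
  funext i
  by_cases hi : ∃ a, e a = i
  · obtain ⟨a, rfl⟩ := hi
    simp [e.injective.extend_apply]
  · simp [Function.extend_apply' _ _ _ hi, h i hi]

theorem blockSum_trans_perm (ξ : X → Fin m → ℝ) (σ : Equiv.Perm (Fin k)) (e : Fin k ↪ ι)
    (η : ι → X) : blockSum ξ (σ.toEmbedding.trans e) η = blockSum ξ e η :=
  Equiv.sum_comp σ fun a => ξ (η (e a))

theorem blockSum_comp_equiv (ξ : X → Fin m → ℝ) (τ : ι' ≃ ι) (e : Fin k ↪ ι) (η : ι → X) :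
    blockSum ξ (e.trans τ.symm.toEmbedding) (η ∘ τ) = blockSum ξ e η := by
  simp [blockSum]

theorem extend_comm {e : Fin k ↪ ι} {e' : Fin l ↪ ι} (h : ∀ a b, e a ≠ e' b)
    (ζ : Fin k → X) (ζ' : Fin l → X) (η : ι → X) :
    Function.extend e' ζ' (Function.extend e ζ η) =
      Function.extend e ζ (Function.extend e' ζ' η) := by
  funext i
  by_cases h1 : ∃ a, e a = i
  · obtain ⟨a, rfl⟩ := h1
    have h2 : ¬ ∃ b, e' b = e a := by
      rintro ⟨b, hb⟩
      exact h a b hb.symm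
    rw [Function.extend_apply' _ _ _ h2, e.injective.extend_apply, e.injective.extend_apply]
  · rw [Function.extend_apply' _ _ _ h1]
    by_cases h2 : ∃ b, e' b = i
    · obtain ⟨b, rfl⟩ := h2
      rw [e'.injective.extend_apply, e'.injective.extend_apply]
    · rw [Function.extend_apply' _ _ _ h2, Function.extend_apply' _ _ _ h2,
        Function.extend_apply' _ _ _ h1]

theorem blockSum_extend_of_disjoint (ξ : X → Fin m → ℝ) {e : Fin k ↪ ι} {e' : Fin l ↪ ι}
    (h : ∀ a b, e a ≠ e' b) (ζ : Fin k → X) (η : ι → X) :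
    blockSum ξ e' (Function.extend e ζ η) = blockSum ξ e' η := by
  refine Finset.sum_congr rfl fun b _ => ?_
  rw [Function.extend_apply']
  rintro ⟨a, ha⟩
  exact h a b ha

variable [MeasurableSpace X] {μ : Measure X} {ξ : X → Fin m → ℝ}
  {ν : ∀ N : ℕ, Kernel (Fin m → ℝ) (Fin N → X)}

/-- The conditioned measures are exchangeable: resample all the variables in a permuted order. -/
theorem IsConditionedProduct.map_perm (hν : IsConditionedProduct μ ξ ν) {ω : Fin m → ℝ}
    (hω : ω ∈ Theta ξ k) (σ : Equiv.Perm (Fin k)) :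
    (ν k ω).map (fun ζ => ζ ∘ σ) = ν k ω := by
  have hm : Measurable fun ζ : Fin k → X => ζ ∘ σ := by fun_prop
  have := hν.prob k ω hω
  ext S hS
  rw [hν.conditional k k σ.symm.toEmbedding ω hω S hS, Measure.map_apply hm hS]
  have h1 : (Finset.univ.map σ.symm.toEmbedding)ᶜ = (∅ : Finset (Fin k)) := by
    simp
  have h2 : ∀ ζ η : Fin k → X, Function.extend σ.symm.toEmbedding ζ η = ζ ∘ σ := fun ζ η => by
    funext i
    have : i = σ.symm.toEmbedding (σ i) := by simp
    rw [this, (Function.Embedding.injective _).extend_apply]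
    simp
  simp only [h1, h2, Finset.sum_empty, sub_zero, lintegral_const, measure_univ, mul_one]
  rfl

theorem blockAvg_trans_perm (hν : IsConditionedProduct μ ξ ν) (σ : Equiv.Perm (Fin k))
    (e : Fin k ↪ ι) {f : (ι → X) → ℝ} (hf : Measurable f) :
    blockAvg ξ ν (σ.toEmbedding.trans e) f = blockAvg ξ ν e f := by
  funext η
  have hm : Measurable fun ζ : Fin k → X => ζ ∘ σ.symm := by fun_prop
  rw [blockAvg, blockSum_trans_perm, blockAvg]
  conv_rhs => rw [← hν.map_perm (blockSum_mem_Theta ξ e η) σ.symm]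
  have hfe : Measurable fun ζ => f (Function.extend e ζ η) :=
    hf.comp (measurable_extend_right e η)
  rw [integral_map hm.aemeasurable hfe.aestronglyMeasurable]
  simp_rw [extend_trans_perm]

theorem blockAvg_comp_equiv (τ : ι' ≃ ι) (e : Fin k ↪ ι) (f : (ι' → X) → ℝ) (η : ι → X) :
    blockAvg ξ ν e (fun η => f (η ∘ τ)) η =
      blockAvg ξ ν (e.trans τ.symm.toEmbedding) f (η ∘ τ) := by
  simp only [blockAvg, extend_comp_equiv, blockSum_comp_equiv]

variable [Fintype ι] [Fintype ι'] {hξ : Measurable ξ} {P : Measure (ι → X)} {ω : Fin m → ℝ}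

/-- Being a Gibbs measure is preserved by a relabelling of the sites. -/
theorem IsGibbs.map_equiv (hP : IsGibbs hξ ν P ω) (hν : IsConditionedProduct μ ξ ν)
    (τ : ι' ≃ ι) : IsGibbs hξ ν (P.map fun η => η ∘ τ) ω := by
  have hm : Measurable fun η : ι → X => η ∘ τ := by fun_prop
  have := hP.prob
  refine ⟨Measure.isProbabilityMeasure_map hm.aemeasurable, ?_, fun k e => ?_⟩
  · rw [ae_map_iff hm.aemeasurable (measurableSet_eq_fun (by fun_prop) (by fun_prop))]
    filter_upwards [hP.sum_eq] with η hη
    rw [← hη]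
    exact Equiv.sum_comp τ fun i => ξ (η i)
  · ext S hS
    have he : (e.trans τ.toEmbedding).trans τ.symm.toEmbedding = e := by ext; simp
    rw [Measure.bind_apply hS (Kernel.aemeasurable _),
      lintegral_map (Kernel.measurable_coe _ hS) hm, Measure.map_apply hm hS]
    conv_rhs => rw [← hP.invariant k (e.trans τ.toEmbedding),
      Measure.bind_apply (hm hS) (Kernel.aemeasurable _)]
    refine lintegral_congr fun η => ?_
    rw [resample_apply hξ hν, resample_apply hξ hν,
      Measure.map_apply (measurable_extend_right _ _) hS,
      Measure.map_apply (measurable_extend_right _ _) (hm hS)]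
    have h1 := blockSum_comp_equiv ξ τ (e.trans τ.toEmbedding) η
    rw [he] at h1
    rw [h1]
    congr 1
    ext ζ
    have h2 := extend_comp_equiv τ (e.trans τ.toEmbedding) ζ η
    rw [he] at h2
    simp only [Set.mem_preimage, h2]

/-- Averages over disjoint blocks commute, by Fubini's theorem. -/
theorem IsGibbs.blockAvg_comm (hP : IsGibbs hξ ν P ω) (hν : IsConditionedProduct μ ξ ν)
    {e : Fin k ↪ ι} {e' : Fin l ↪ ι} (h : ∀ a b, e a ≠ e' b) {f : (ι → X) → ℝ}
    (hf : Measurable f) (hfi : Integrable f P) :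
    blockAvg ξ ν e (blockAvg ξ ν e' f) =ᵐ[P] blockAvg ξ ν e' (blockAvg ξ ν e f) := by
  have hfe : Measurable fun η => ‖f η‖ₑ := hf.enorm
  have hG : Measurable fun θ =>
      ∫⁻ ζ', ‖f (Function.extend e' ζ' θ)‖ₑ ∂(ν l (blockSum ξ e' θ)) := by
    simp_rw [← lintegral_resample hξ hν e' _ hfe]
    exact hfe.lintegral_kernel
  have hGe : Measurable fun η => ∫⁻ ζ, ∫⁻ ζ',
      ‖f (Function.extend e' ζ' (Function.extend e ζ η))‖ₑ
        ∂(ν l (blockSum ξ e' (Function.extend e ζ η))) ∂(ν k (blockSum ξ e η)) := by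
    simp_rw [← lintegral_resample hξ hν e _ hG]
    exact hG.lintegral_kernel
  have hfin : ∀ᵐ η ∂P, ∫⁻ ζ, ∫⁻ ζ', ‖f (Function.extend e' ζ' (Function.extend e ζ η))‖ₑ
        ∂(ν l (blockSum ξ e' (Function.extend e ζ η))) ∂(ν k (blockSum ξ e η)) < ⊤ := by
    refine ae_lt_top hGe ?_
    rw [hP.lintegral_eq hν e hG, hP.lintegral_eq hν e' hfe]
    exact hfi.2.ne
  filter_upwards [hfin] with η hη
  have := hν.isProbabilityMeasure_blockSum e η
  have := hν.isProbabilityMeasure_blockSum e' η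
  simp only [blockAvg, blockSum_extend_of_disjoint ξ h,
    blockSum_extend_of_disjoint ξ fun a b => (h b a).symm] at hη ⊢
  simp_rw [← extend_comm h]
  have hm : Measurable fun p : (Fin k → X) × (Fin l → X) =>
      f (Function.extend e' p.2 (Function.extend e p.1 η)) :=
    hf.comp ((measurable_extend e').comp
      (((measurable_extend_right e η).comp measurable_fst).prodMk measurable_snd))
  have hint : HasFiniteIntegral (fun p : (Fin k → X) × (Fin l → X) =>
      f (Function.extend e' p.2 (Function.extend e p.1 η)))
      ((ν k (blockSum ξ e η)).prod (ν l (blockSum ξ e' η))) := by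
    rw [HasFiniteIntegral, lintegral_prod _ hm.enorm.aemeasurable]
    exact hη
  exact integral_integral_swap (f := fun ζ ζ' =>
    f (Function.extend e' ζ' (Function.extend e ζ η))) ⟨hm.aestronglyMeasurable, hint⟩

end Relabelling

/-! ### Averages over pairs as orthogonal projections -/

section Projection

variable {X : Type*} [MeasurableSpace X] {m : ℕ} {ι : Type*}

theorem outsideSigma_le (i j : ι) :
    (outsideSigma i j : MeasurableSpace (ι → X)) ≤ MeasurableSpace.pi :=
  Measurable.comap_le (measurable_pi_lambda _ fun k => measurable_pi_apply k.1)

variable {P : Measure (ι → X)}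

/-- The orthogonal projection of `L²(P)` onto the functions of the variables outside `i, j`. -/
def pairProj (P : Measure (ι → X)) (i j : ι) : Lp ℝ 2 P →L[ℝ] Lp ℝ 2 P :=
  (lpMeas ℝ ℝ (outsideSigma i j) 2 P).subtypeL ∘L condExpL2 ℝ ℝ (outsideSigma_le i j)

theorem pairProj_ae_eq_condExp [IsFiniteMeasure P] (i j : ι) {f : (ι → X) → ℝ}
    (hf : MemLp f 2 P) : pairProj P i j hf.toLp =ᵐ[P] P[f | outsideSigma i j] :=
  hf.condExpL2_ae_eq_condExp (outsideSigma_le i j)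

theorem inner_pairProj_left (i j : ι) (u v : Lp ℝ 2 P) :
    inner ℝ (pairProj P i j u) v = inner ℝ u (pairProj P i j v) :=
  inner_condExpL2_left_eq_right (outsideSigma_le i j)

theorem pairProj_pairProj (i j : ι) (u : Lp ℝ 2 P) :
    pairProj P i j (pairProj P i j u) = pairProj P i j u := by
  have : Fact ((outsideSigma i j : MeasurableSpace (ι → X)) ≤ MeasurableSpace.pi) :=
    ⟨outsideSigma_le i j⟩
  exact congrArg Subtype.val (Submodule.orthogonalProjectionOnto_mem_subspace_eq_self
    (K := lpMeas ℝ ℝ (outsideSigma i j) 2 P) (condExpL2 ℝ ℝ (outsideSigma_le i j) u))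

variable [Fintype ι] {μ : Measure X} {ξ : X → Fin m → ℝ} {hξ : Measurable ξ}
  {ν : ∀ N : ℕ, Kernel (Fin m → ℝ) (Fin N → X)} {ω : Fin m → ℝ}

/-- The average over a pair agrees almost surely with a function of the variables outside it: the
conserved quantity of the pair is `ω` minus that of the other sites. -/
theorem IsGibbs.aestronglyMeasurable_outsideSigma (hP : IsGibbs hξ ν P ω)
    (hν : IsConditionedProduct μ ξ ν) (e : Fin 2 ↪ ι) {f : (ι → X) → ℝ} (hf : Measurable f) :
    AEStronglyMeasurable[outsideSigma (e 0) (e 1)] (blockAvg ξ ν e f) P := by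
  classical
  have := hP.prob
  obtain ⟨η₀⟩ : Nonempty (ι → X) := P.nonempty_of_neZero
  let s : (ι → X) → Fin m → ℝ := fun η => ω - ∑ i ∈ (Finset.univ.map e)ᶜ, ξ (η i)
  have hs : Measurable s := by fun_prop
  let R : (ι → X) → {k : ι // k ≠ e 0 ∧ k ≠ e 1} → X := fun η k => η k
  let glue : ({k : ι // k ≠ e 0 ∧ k ≠ e 1} → X) → ι → X := fun ρ =>
    Function.extend Subtype.val ρ η₀
  have hglue : Measurable glue := by
    refine measurable_pi_iff.2 fun i => ?_
    by_cases h : ∃ a : {k : ι // k ≠ e 0 ∧ k ≠ e 1}, a.1 = i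
    · obtain ⟨a, rfl⟩ := h
      simp only [glue, Subtype.val_injective.extend_apply]
      fun_prop
    · simp only [glue, Function.extend_apply' _ _ _ h]
      fun_prop
  have hgl : ∀ η i, (¬ ∃ a, e a = i) → glue (R η) i = η i := fun η i hi => by
    have h0 : i ≠ e 0 ∧ i ≠ e 1 := ⟨fun h => hi ⟨0, h.symm⟩, fun h => hi ⟨1, h.symm⟩⟩
    exact Subtype.val_injective.extend_apply (R η) η₀ ⟨i, h0⟩
  let F : (ι → X) → ℝ := fun η => ∫ θ, f θ ∂(refresh ν e s hs η)
  have hF : Measurable F := hf.stronglyMeasurable.integral_kernel.measurable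
  -- `F` has the value of the average when the conserved quantity is `ω`, and it does not see
  -- the variables listed by `e`.
  have hFR : F = fun η => F (glue (R η)) := by
    funext η
    have h1 : s (glue (R η)) = s η := by
      simp only [s]
      congr 1
      refine Finset.sum_congr rfl fun i hi => ?_
      rw [hgl]
      simpa using hi
    simp only [F, refresh_apply, h1]
    simp_rw [extend_congr e _ (hgl η)]
  refine ⟨F, ?_, ?_⟩
  · rw [hFR]
    exact ((hF.comp hglue).comp (comap_measurable R)).stronglyMeasurable
  · filter_upwards [hP.sum_eq] with η hη
    have h1 : s η = blockSum ξ e η := by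
      simp only [s]
      rw [← hη, ← sum_compl_add_blockSum ξ e η, add_sub_cancel_left]
    have := hν.isProbabilityMeasure_blockSum e η
    rw [← integral_resample hξ hν e η hf]
    simp only [F]
    rw [refresh_apply, h1, probPart_apply, resample_apply hξ hν]

/-- The conditional expectation given the variables outside a pair is the average over it. -/
theorem IsGibbs.condExp_ae_eq (hP : IsGibbs hξ ν P ω) (hν : IsConditionedProduct μ ξ ν)
    (e : Fin 2 ↪ ι) {f : (ι → X) → ℝ} (hf : Measurable f) (hfi : Integrable f P) :
    P[f | outsideSigma (e 0) (e 1)] =ᵐ[P] blockAvg ξ ν e f := by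
  have := hP.prob
  symm
  refine ae_eq_condExp_of_forall_setIntegral_eq (outsideSigma_le _ _) hfi
    (fun _ _ _ => (hP.integrable_blockAvg hν e hf hfi).integrableOn) (fun S hS _ => ?_)
    (hP.aestronglyMeasurable_outsideSigma hν e hf)
  have hS' : MeasurableSet S := outsideSigma_le _ _ S hS
  obtain ⟨S', -, hSS⟩ := hS
  rw [← integral_indicator hS', ← integral_indicator hS',
    ← hP.integral_eq hν e (hf.indicator hS') (hfi.indicator hS')]
  congr 1
  funext η
  have h1 : ∀ ζ : Fin 2 → X, Function.extend e ζ η ∈ S ↔ η ∈ S := fun ζ => by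
    have : ∀ k : {k : ι // k ≠ e 0 ∧ k ≠ e 1}, Function.extend e ζ η k = η k := by
      intro k
      refine Function.extend_apply' _ _ _ ?_
      rintro ⟨a, ha⟩
      fin_cases a
      · exact k.2.1 ha.symm
      · exact k.2.2 ha.symm
    simp only [← hSS, Set.mem_preimage, this]
  by_cases hη : η ∈ S
  · simp [blockAvg, hη, Set.indicator, h1]
  · simp [blockAvg, hη, Set.indicator, h1]

/-- The embedding of `Fin 2` listing a pair of distinct sites. -/
def pairEmb {i j : ι} (h : i ≠ j) : Fin 2 ↪ ι where
  toFun := ![i, j]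
  inj' a b := by
    fin_cases a <;> fin_cases b <;> simp [h, h.symm]

theorem IsGibbs.pairProj_toLp (hP : IsGibbs hξ ν P ω) (hν : IsConditionedProduct μ ξ ν)
    {i j : ι} (h : i ≠ j) {f : (ι → X) → ℝ} (hf : Measurable f) (hfL : MemLp f 2 P) :
    pairProj P i j hfL.toLp =ᵐ[P] blockAvg ξ ν (pairEmb h) f := by
  have := hP.prob
  exact (pairProj_ae_eq_condExp i j hfL).trans
    (hP.condExp_ae_eq hν (pairEmb h) hf (hfL.integrable one_le_two))

theorem IsGibbs.pairProj_ae_eq (hP : IsGibbs hξ ν P ω) (hν : IsConditionedProduct μ ξ ν)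
    {i j : ι} (h : i ≠ j) (u : Lp ℝ 2 P) :
    pairProj P i j u =ᵐ[P] blockAvg ξ ν (pairEmb h) u := by
  have := hP.pairProj_toLp hν h (Lp.stronglyMeasurable u).measurable (Lp.memLp u)
  rwa [Lp.toLp_coeFn] at this

theorem IsGibbs.pairProj_pairProj_ae_eq (hP : IsGibbs hξ ν P ω)
    (hν : IsConditionedProduct μ ξ ν) {i j k l : ι} (h : i ≠ j) (h' : k ≠ l) (u : Lp ℝ 2 P) :
    pairProj P i j (pairProj P k l u) =ᵐ[P]
      blockAvg ξ ν (pairEmb h) (blockAvg ξ ν (pairEmb h') u) :=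
  (hP.pairProj_ae_eq hν h _).trans (hP.blockAvg_congr hν _ (hP.pairProj_ae_eq hν h' u))

theorem IsGibbs.pairProj_comm (hP : IsGibbs hξ ν P ω) (hν : IsConditionedProduct μ ξ ν)
    {i j k l : ι} (hij : i ≠ j) (hkl : k ≠ l) (hik : i ≠ k) (hil : i ≠ l) (hjk : j ≠ k)
    (hjl : j ≠ l) (u : Lp ℝ 2 P) :
    pairProj P i j (pairProj P k l u) = pairProj P k l (pairProj P i j u) := by
  have := hP.prob
  refine Lp.ext ?_
  refine (hP.pairProj_pairProj_ae_eq hν hij hkl u).trans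
    (.trans ?_ (hP.pairProj_pairProj_ae_eq hν hkl hij u).symm)
  refine hP.blockAvg_comm hν (fun a b => ?_) (Lp.stronglyMeasurable u).measurable
    ((Lp.memLp u).integrable one_le_two)
  fin_cases a <;> fin_cases b <;> assumption

theorem IsGibbs.pairProj_symm (hP : IsGibbs hξ ν P ω) (hν : IsConditionedProduct μ ξ ν)
    {i j : ι} (h : i ≠ j) (u : Lp ℝ 2 P) : pairProj P i j u = pairProj P j i u := by
  refine Lp.ext ((hP.pairProj_ae_eq hν h u).trans (.trans ?_ (hP.pairProj_ae_eq hν h.symm u).symm))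
  have he : pairEmb h = (Equiv.swap 0 1).toEmbedding.trans (pairEmb h.symm) := by
    ext a
    fin_cases a <;> rfl
  rw [he, blockAvg_trans_perm hν _ _ (Lp.stronglyMeasurable u).measurable]

end Projection

/-! ### Positive operators on a Hilbert space -/

section Hilbert

variable {H : Type*} [NormedAddCommGroup H] [InnerProductSpace ℝ H]

/-- If `A` is symmetric, nonnegative and `A² ≥ c A`, then `A ≥ c` on the orthogonal complement of
the kernel. -/
theorem mul_norm_sq_le_inner_of_mul_inner_le_norm_sq [CompleteSpace H] (A : H →L[ℝ] H)
    (hsymm : ∀ u v, inner ℝ (A u) v = inner ℝ u (A v)) (hpos : ∀ u, 0 ≤ inner ℝ u (A u)) {c : ℝ}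
    (hc : 0 ≤ c) (hsq : ∀ u, c * inner ℝ u (A u) ≤ ‖A u‖ ^ 2) {f : H}
    (hf : ∀ u, A u = 0 → inner ℝ u f = 0) : c * ‖f‖ ^ 2 ≤ inner ℝ f (A f) := by
  have hadj : A.adjoint = A :=
    (((ContinuousLinearMap.eq_adjoint_iff A A).2 hsymm)).symm
  have hmem : f ∈ A.range.topologicalClosure := by
    have h := ContinuousLinearMap.orthogonal_ker A
    rw [hadj] at h
    rw [← h]
    exact fun u hu => hf u hu
  have hclosed : IsClosed {g : H | c * ‖g‖ ^ 2 ≤ inner ℝ g (A g)} :=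
    isClosed_le (by fun_prop) (by fun_prop)
  refine closure_minimal (s := (A.range : Set H)) ?_ hclosed hmem
  rintro _ ⟨g, rfl⟩
  -- the form of `A` is nonnegative at `A g - c g`
  have h1 := hpos (A g - c • g)
  have h2 := hsq g
  have h3 : inner ℝ (A g) (A g) = ‖A g‖ ^ 2 := real_inner_self_eq_norm_sq _
  have h4 : inner ℝ g (A (A g)) = ‖A g‖ ^ 2 := by rw [← hsymm, h3]
  simp only [map_sub, map_smul, inner_sub_left, inner_sub_right, real_inner_smul_left,
    real_inner_smul_right, h3, h4] at h1
  have h5 : inner ℝ (A g) (c • A g) = c * ‖A g‖ ^ 2 := by rw [real_inner_smul_right, h3]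
  change c * ‖A g‖ ^ 2 ≤ inner ℝ (A g) (A (A g))
  nlinarith

/-- Summation over triples: a lower bound for the square of a sum of vectors indexed by pairs,
given lower bounds for all triples of sites and nonnegative inner products for disjoint pairs. -/
theorem norm_sq_sum_pairs_ge {ι : Type*} [Fintype ι] (d : ι → ι → H) (hd : ∀ i, d i i = 0)
    (hsymm : ∀ i j, d i j = d j i) {κ : ℝ}
    (hdisj : ∀ i j k l, i ≠ j → k ≠ l → i ≠ k → i ≠ l → j ≠ k → j ≠ l →
      0 ≤ inner ℝ (d i j) (d k l))
    (htri : ∀ i j k, i ≠ j → j ≠ k → i ≠ k →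
      κ * (‖d i j‖ ^ 2 + ‖d j k‖ ^ 2 + ‖d i k‖ ^ 2) ≤ ‖d i j + d j k + d i k‖ ^ 2) :
    2 * (1 + (κ - 1) * ((Fintype.card ι : ℝ) - 2)) * ∑ i, ∑ j, ‖d i j‖ ^ 2 ≤
      ‖∑ i, ∑ j, d i j‖ ^ 2 := by
  classical
  set S := ∑ i, ∑ j, ‖d i j‖ ^ 2 with hS
  set W := ∑ i, ∑ j, ∑ k, inner ℝ (d i j) (d j k) with hW
  have hself : ∀ i j, inner ℝ (d i j) (d i j) = ‖d i j‖ ^ 2 := fun i j =>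
    real_inner_self_eq_norm_sq _
  have hself' : ∀ i j, inner ℝ (d i j) (d j i) = ‖d i j‖ ^ 2 := fun i j => by
    rw [hsymm j i, hself]
  have h0l : ∀ i (v : H), inner ℝ (d i i) v = 0 := fun i v => by rw [hd, inner_zero_left]
  have h0r : ∀ i (v : H), inner ℝ v (d i i) = 0 := fun i v => by rw [hd, inner_zero_right]
  have hn0 : ∀ i, ‖d i i‖ = 0 := fun i => by rw [hd, norm_zero]
  have hnsymm : ∀ i j, ‖d i j‖ = ‖d j i‖ := fun i j => by rw [hsymm]
  -- the triples; the subtracted terms make the inequality hold with repeated sites too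
  have hF : ∀ i j k, 0 ≤ (1 - κ) * (‖d i j‖ ^ 2 + ‖d j k‖ ^ 2 + ‖d i k‖ ^ 2) +
      2 * (inner ℝ (d i j) (d j k) + inner ℝ (d i k) (d k j) + inner ℝ (d j i) (d i k)) -
      (if i = j then (4 - 2 * κ) * ‖d i k‖ ^ 2 else 0) -
      (if j = k then (4 - 2 * κ) * ‖d i j‖ ^ 2 else 0) -
      (if i = k then (4 - 2 * κ) * ‖d i j‖ ^ 2 else 0) := by
    intro i j k
    by_cases hij : i = j
    · subst hij
      by_cases hjk : i = k
      · subst hjk; simp [hn0]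
      · simp only [hjk, if_true, if_false, hn0, h0l, hself']
        linarith
    by_cases hjk : j = k
    · subst hjk
      simp only [hij, if_true, if_false, hn0, h0r, hself', hnsymm j i]
      linarith
    by_cases hik : i = k
    · subst hik
      simp only [hij, hjk, if_true, if_false, hn0, h0l, h0r, hself', hnsymm j i]
      linarith
    simp only [hij, hjk, hik, if_false, sub_zero]
    have h := htri i j k hij hjk hik
    rw [← real_inner_self_eq_norm_sq (d i j + d j k + d i k)] at h
    simp only [inner_add_left, inner_add_right, hself] at h
    rw [real_inner_comm (d i j) (d j k), real_inner_comm (d i j) (d i k),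
      real_inner_comm (d j k) (d i k)] at h
    rw [hsymm k j, hsymm j i]
    linarith [real_inner_comm (d i k) (d j k)]
  have hFs := Finset.sum_nonneg fun i (_ : i ∈ Finset.univ) => Finset.sum_nonneg
    fun j (_ : j ∈ Finset.univ) => Finset.sum_nonneg fun k (_ : k ∈ Finset.univ) => hF i j k
  have e1 : ∑ i, ∑ j, ∑ _k : ι, ‖d i j‖ ^ 2 = Fintype.card ι * S := by
    simp [hS, Finset.mul_sum]
  have e2 : ∑ _i : ι, ∑ j, ∑ k, ‖d j k‖ ^ 2 = Fintype.card ι * S := by simp [hS]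
  have e3 : ∑ i, ∑ _j : ι, ∑ k, ‖d i k‖ ^ 2 = Fintype.card ι * S := by simp [hS, Finset.mul_sum]
  have e4 : ∑ i, ∑ j, ∑ k, inner ℝ (d i k) (d k j) = W := by
    rw [hW]
    exact Finset.sum_congr rfl fun i _ => Finset.sum_comm
  have e5 : ∑ i, ∑ j, ∑ k, inner ℝ (d j i) (d i k) = W := by
    rw [hW]
    exact Finset.sum_comm
  have e6 : ∑ i, ∑ j, ∑ k, (if i = j then (4 - 2 * κ) * ‖d i k‖ ^ 2 else 0) =
      (4 - 2 * κ) * S := by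
    rw [hS, Finset.mul_sum]
    refine Finset.sum_congr rfl fun i _ => ?_
    rw [Finset.sum_comm, Finset.mul_sum]
    simp
  have e7 : ∑ i, ∑ j, ∑ k, (if j = k then (4 - 2 * κ) * ‖d i j‖ ^ 2 else 0) =
      (4 - 2 * κ) * S := by
    simp [hS, Finset.mul_sum]
  have e8 : ∑ i, ∑ j, ∑ k, (if i = k then (4 - 2 * κ) * ‖d i j‖ ^ 2 else 0) =
      (4 - 2 * κ) * S := by
    simp [hS, Finset.mul_sum]
  simp only [Finset.sum_add_distrib, Finset.sum_sub_distrib, ← Finset.mul_sum, e1, e2, e3, e4, e5,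
    e6, e7, e8, ← hW] at hFs
  -- the square, by the number of common sites of the two pairs
  have hq : ∀ i j k l,
      (if k = j then inner ℝ (d i j) (d j l) else 0) +
      (if l = j then inner ℝ (d i j) (d j k) else 0) +
      (if k = i then inner ℝ (d j i) (d i l) else 0) +
      (if l = i then inner ℝ (d j i) (d i k) else 0) -
      (if k = i then if l = j then ‖d i j‖ ^ 2 else 0 else 0) -
      (if k = j then if l = i then ‖d i j‖ ^ 2 else 0 else 0) ≤ inner ℝ (d i j) (d k l) := by
    intro i j k l
    by_cases hij : i = j
    · subst hij
      simp [h0l, hn0]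
    by_cases hkl : k = l
    · subst hkl
      by_cases h1 : k = j
      · subst h1; simp [h0r, Ne.symm hij]
      · by_cases h2 : k = i
        · subst h2; simp [h0r, h1]
        · simp [h1, h2, h0r]
    by_cases h1 : k = j
    · subst h1
      by_cases h2 : l = i
      · subst h2
        simp [hkl, Ne.symm hkl, hself', hnsymm k l]
      · simp [h2, Ne.symm hkl, Ne.symm hij]
    by_cases h2 : k = i
    · subst h2
      by_cases h3 : l = j
      · subst h3
        simp [hkl, Ne.symm hkl, hself', hnsymm l k]
      · simp [h1, h3, Ne.symm hkl, hsymm j k]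
    by_cases h3 : l = j
    · subst h3
      simp [h1, h2, Ne.symm hij, hsymm l k]
    by_cases h4 : l = i
    · subst h4
      simp [h1, h2, h3, hsymm j l, hsymm k l]
    simp only [h1, h2, h3, h4, if_false, add_zero, sub_zero]
    exact hdisj i j k l hij hkl (Ne.symm h2) (Ne.symm h4) (Ne.symm h1) (Ne.symm h3)
  have hqs := Finset.sum_le_sum fun i (_ : i ∈ Finset.univ) => Finset.sum_le_sum
    fun j (_ : j ∈ Finset.univ) => Finset.sum_le_sum fun k (_ : k ∈ Finset.univ) =>
    Finset.sum_le_sum fun l (_ : l ∈ Finset.univ) => hq i j k l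
  have f0 : ∑ i, ∑ j, ∑ k, ∑ l, inner ℝ (d i j) (d k l) = ‖∑ i, ∑ j, d i j‖ ^ 2 := by
    rw [← real_inner_self_eq_norm_sq]
    simp only [sum_inner, inner_sum]
    exact Finset.sum_congr rfl fun i _ => Finset.sum_congr rfl fun j _ =>
      Finset.sum_congr rfl fun k _ => Finset.sum_congr rfl fun l _ => real_inner_comm _ _
  have f1 : ∑ i, ∑ j, ∑ k, ∑ l, (if k = j then inner ℝ (d i j) (d j l) else 0) = W := by
    rw [hW]
    refine Finset.sum_congr rfl fun i _ => Finset.sum_congr rfl fun j _ => ?_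
    rw [Finset.sum_comm]
    simp
  have f2 : ∑ i, ∑ j, ∑ k, ∑ l, (if l = j then inner ℝ (d i j) (d j k) else 0) = W := by
    simp [hW]
  have f3 : ∑ i, ∑ j, ∑ k, ∑ l, (if k = i then inner ℝ (d j i) (d i l) else 0) = W := by
    rw [← e5]
    refine Finset.sum_congr rfl fun i _ => Finset.sum_congr rfl fun j _ => ?_
    rw [Finset.sum_comm]
    simp
  have f4 : ∑ i, ∑ j, ∑ k, ∑ l, (if l = i then inner ℝ (d j i) (d i k) else 0) = W := by
    rw [← e5]
    simp
  have f5 : ∑ i, ∑ j, ∑ k, ∑ l, (if k = i then if l = j then ‖d i j‖ ^ 2 else 0 else 0) = S := by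
    rw [hS]
    refine Finset.sum_congr rfl fun i _ => Finset.sum_congr rfl fun j _ => ?_
    rw [Finset.sum_comm]
    simp
  have f6 : ∑ i, ∑ j, ∑ k, ∑ l, (if k = j then if l = i then ‖d i j‖ ^ 2 else 0 else 0) = S := by
    rw [hS]
    refine Finset.sum_congr rfl fun i _ => Finset.sum_congr rfl fun j _ => ?_
    rw [Finset.sum_comm]
    simp
  simp only [Finset.sum_add_distrib, Finset.sum_sub_distrib, f0, f1, f2, f3, f4, f5, f6] at hqs
  linarith

end Hilbert

/-! ### The gap of the averaging process as an inequality in `L²` -/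

section AverageGap

theorem Lp_inner_eq_integral {Ω : Type*} [MeasurableSpace Ω] {P : Measure Ω} {u v : Lp ℝ 2 P}
    {f g : Ω → ℝ} (hu : u =ᵐ[P] f) (hv : v =ᵐ[P] g) : inner ℝ u v = ∫ η, f η * g η ∂P := by
  rw [L2.inner_def]
  refine integral_congr_ae ?_
  filter_upwards [hu, hv] with η h1 h2
  rw [h1, h2, real_inner_comm]
  rfl

theorem Lp_norm_sq_eq_integral {Ω : Type*} [MeasurableSpace Ω] {P : Measure Ω} {u : Lp ℝ 2 P}
    {f : Ω → ℝ} (hu : u =ᵐ[P] f) : ‖u‖ ^ 2 = ∫ η, f η ^ 2 ∂P := by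
  rw [← real_inner_self_eq_norm_sq, Lp_inner_eq_integral hu hu]
  simp_rw [sq]

variable {X : Type*} [MeasurableSpace X] {ι : Type*} {P : Measure (ι → X)}

theorem norm_sub_pairProj_sq (i j : ι) (u : Lp ℝ 2 P) :
    ‖u - pairProj P i j u‖ ^ 2 = inner ℝ u (u - pairProj P i j u) := by
  have h : inner ℝ (pairProj P i j u) (u - pairProj P i j u) = 0 := by
    rw [inner_pairProj_left, map_sub, pairProj_pairProj, sub_self, inner_zero_right]
  rw [← real_inner_self_eq_norm_sq, inner_sub_left, h, sub_zero]

variable [IsProbabilityMeasure P]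

theorem pairProj_const (i j : ι) (a : ℝ) :
    pairProj P i j (Lp.const 2 P a) = Lp.const 2 P a := by
  refine Lp.ext ?_
  have h1 : (Lp.const 2 P a : Lp ℝ 2 P) = (memLp_const a).toLp := rfl
  rw [h1]
  refine (pairProj_ae_eq_condExp i j (memLp_const a)).trans ?_
  rw [condExp_const (outsideSigma_le i j)]
  exact (MemLp.coeFn_toLp _).symm

/-- The function `u` minus its mean. -/
def centered (u : Lp ℝ 2 P) : Lp ℝ 2 P := u - Lp.const 2 P (∫ η, u η ∂P)

theorem integral_centered (u : Lp ℝ 2 P) : ∫ η, centered u η ∂P = 0 := by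
  have h1 : centered u =ᵐ[P] fun η => u η - ∫ η, u η ∂P := by
    filter_upwards [Lp.coeFn_sub u (Lp.const 2 P (∫ η, u η ∂P)),
      Lp.coeFn_const (p := 2) P (∫ η, u η ∂P)] with η h2 h3
    rw [centered, h2, Pi.sub_apply, h3]
    rfl
  rw [integral_congr_ae h1, integral_sub ((Lp.memLp u).integrable one_le_two)
    (integrable_const _)]
  simp

theorem centered_sub_pairProj (i j : ι) (u : Lp ℝ 2 P) :
    centered u - pairProj P i j (centered u) = u - pairProj P i j u := by
  rw [centered, map_sub, pairProj_const, sub_sub_sub_cancel_right]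

/-- The Dirichlet form of the averaging process is a sum of squared distances, since the pair
averages are orthogonal projections. -/
theorem integral_mul_neg_averageGen (B : Finset (ι × ι)) (a : ℝ) {f : (ι → X) → ℝ}
    (hf : MemLp f 2 P) :
    ∫ η, f η * -(a * ∑ b ∈ B, ((P[f | outsideSigma b.1 b.2]) η - f η)) ∂P =
      a * ∑ b ∈ B, ‖hf.toLp - pairProj P b.1 b.2 hf.toLp‖ ^ 2 := by
  have h1 : ((a • ∑ b ∈ B, (hf.toLp - pairProj P b.1 b.2 hf.toLp) : Lp ℝ 2 P) : (ι → X) → ℝ)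
      =ᵐ[P] fun η => -(a * ∑ b ∈ B, ((P[f | outsideSigma b.1 b.2]) η - f η)) := by
    have h2 : ∀ᵐ η ∂P, ∀ b ∈ B, (hf.toLp - pairProj P b.1 b.2 hf.toLp : Lp ℝ 2 P) η =
        f η - (P[f | outsideSigma b.1 b.2]) η := by
      rw [Finset.eventually_all]
      intro b _
      filter_upwards [Lp.coeFn_sub hf.toLp (pairProj P b.1 b.2 hf.toLp), hf.coeFn_toLp,
        pairProj_ae_eq_condExp b.1 b.2 hf] with η h3 h4 h5
      rw [h3, Pi.sub_apply, h4, h5]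
    filter_upwards [h2, Lp.coeFn_smul a (∑ b ∈ B, (hf.toLp - pairProj P b.1 b.2 hf.toLp)),
      Lp.coeFn_finsetSum B fun b => hf.toLp - pairProj P b.1 b.2 hf.toLp] with η h3 h4 h5
    rw [h4, Pi.smul_apply, h5, Finset.sum_apply, Finset.sum_congr rfl h3, smul_eq_mul,
      ← mul_neg, ← Finset.sum_neg_distrib]
    simp only [neg_sub]
  rw [← Lp_inner_eq_integral hf.coeFn_toLp h1, real_inner_smul_right, inner_sum]
  simp_rw [norm_sub_pairProj_sq]

theorem le_gap_isAverageGen_iff (B : Finset (ι × ι)) (a c : ℝ) :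
    (c : EReal) ≤ gap P (IsAverageGen P B a) ↔ ∀ u : Lp ℝ 2 P, ∫ η, u η ∂P = 0 →
      c * ‖u‖ ^ 2 ≤ a * ∑ b ∈ B, ‖u - pairProj P b.1 b.2 u‖ ^ 2 := by
  constructor
  · intro h u hu
    by_cases h0 : u = 0
    · simp [h0]
    have hpos : 0 < ‖u‖ ^ 2 := by positivity
    have hn := Lp_norm_sq_eq_integral (u := u) (.refl _ _)
    have h1 := h.trans (iInf_le _ (u : (ι → X) → ℝ))
    have h2 := h1.trans ((iInf_le _ _).trans ((iInf_le _ (Lp.memLp u)).trans ((iInf_le _ rfl).trans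
      ((iInf_le _ hu).trans (iInf_le _ (by rw [← hn]; exact hpos.ne'))))))
    rw [EReal.coe_le_coe_iff, integral_mul_neg_averageGen B a (Lp.memLp u), ← hn,
      le_div_iff₀ hpos, Lp.toLp_coeFn] at h2
    exact h2
  · intro h
    refine le_iInf fun f => le_iInf fun g => le_iInf fun hf => le_iInf fun hg => le_iInf fun hm =>
      le_iInf fun h0 => ?_
    have hn := Lp_norm_sq_eq_integral hf.coeFn_toLp
    have hpos : 0 < ‖hf.toLp‖ ^ 2 := lt_of_le_of_ne (by positivity) (by rw [hn]; exact h0.symm)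
    subst hg
    rw [EReal.coe_le_coe_iff, integral_mul_neg_averageGen B a hf, ← hn, le_div_iff₀ hpos]
    exact h _ (by rw [integral_congr_ae hf.coeFn_toLp, hm])

end AverageGap

/-! ### From three sites to the complete graph -/

section MeanField

variable {X : Type*} {m : ℕ} {ι : Type*} {k l : ℕ}

theorem extend_trans_extend (b : Fin l ↪ Fin k) (e : Fin k ↪ ι) (ζ' : Fin l → X) (ζ : Fin k → X)
    (η : ι → X) : Function.extend (b.trans e) ζ' (Function.extend e ζ η) =
      Function.extend e (Function.extend b ζ' ζ) η := by
  funext i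
  by_cases h : ∃ a, e a = i
  · obtain ⟨a, rfl⟩ := h
    rw [e.injective.extend_apply]
    by_cases h' : ∃ c, b c = a
    · obtain ⟨c, rfl⟩ := h'
      rw [b.injective.extend_apply]
      exact (b.trans e).injective.extend_apply ζ' _ c
    · rw [Function.extend_apply' _ _ _ h', Function.extend_apply', e.injective.extend_apply]
      rintro ⟨c, hc⟩
      exact h' ⟨c, e.injective hc⟩
  · rw [Function.extend_apply' _ _ _ h, Function.extend_apply', Function.extend_apply' _ _ _ h]
    rintro ⟨c, hc⟩
    exact h ⟨b c, hc⟩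

theorem blockSum_trans_extend (ξ : X → Fin m → ℝ) (b : Fin l ↪ Fin k) (e : Fin k ↪ ι)
    (ζ : Fin k → X) (η : ι → X) :
    blockSum ξ (b.trans e) (Function.extend e ζ η) = blockSum ξ b ζ := by
  simp [blockSum, e.injective.extend_apply]

variable [MeasurableSpace X] {μ : Measure X} {ξ : X → Fin m → ℝ} {hξ : Measurable ξ}
  {ν : ∀ N : ℕ, Kernel (Fin m → ℝ) (Fin N → X)}

/-- The average over a sub-block is an average of the function of the variables in the block. -/
theorem blockAvg_trans_extend (b : Fin l ↪ Fin k) (e : Fin k ↪ ι) (f : (ι → X) → ℝ)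
    (ζ : Fin k → X) (η : ι → X) :
    blockAvg ξ ν (b.trans e) f (Function.extend e ζ η) =
      blockAvg ξ ν b (fun ζ => f (Function.extend e ζ η)) ζ := by
  simp only [blockAvg, extend_trans_extend, blockSum_trans_extend]

theorem sum_completePairs_three (F : Fin 3 × Fin 3 → ℝ) :
    ∑ b ∈ completePairs 3, F b = F (0, 1) + F (1, 2) + F (0, 2) := by
  have h : completePairs 3 = {(0, 1), (1, 2), (0, 2)} := by decide
  rw [h, Finset.sum_insert (by decide), Finset.sum_insert (by decide), Finset.sum_singleton]
  ring

/-- A spectral gap `κ` for three sites, in the form `A² ≥ κ A` for the sum `A` of the three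
projections. -/
theorem norm_sq_sum_three_ge {P : Measure (Fin 3 → X)} [IsProbabilityMeasure P] {κ : ℝ}
    (hκ : 0 < κ) (hgap : ((κ / 3 : ℝ) : EReal) ≤
      gap P (IsAverageGen P (completePairs 3) (1 / ((3 : ℕ) : ℝ)))) (u : Lp ℝ 2 P) :
    κ * (‖u - pairProj P 0 1 u‖ ^ 2 + ‖u - pairProj P 1 2 u‖ ^ 2 + ‖u - pairProj P 0 2 u‖ ^ 2) ≤
      ‖(u - pairProj P 0 1 u) + (u - pairProj P 1 2 u) + (u - pairProj P 0 2 u)‖ ^ 2 := by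
  have h1 := (le_gap_isAverageGen_iff (completePairs 3) _ _).1 hgap (centered u)
    (integral_centered u)
  simp only [sum_completePairs_three, centered_sub_pairProj] at h1
  push_cast at h1
  set s := ‖u - pairProj P 0 1 u‖ ^ 2 + ‖u - pairProj P 1 2 u‖ ^ 2 + ‖u - pairProj P 0 2 u‖ ^ 2
    with hs
  set w := (u - pairProj P 0 1 u) + (u - pairProj P 1 2 u) + (u - pairProj P 0 2 u) with hw
  have h2 : s = inner ℝ (centered u) w := by
    rw [hs, hw, inner_add_right, inner_add_right]
    simp only [← centered_sub_pairProj _ _ u, norm_sub_pairProj_sq]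
  have h3 := real_inner_le_norm (centered u) w
  rw [← h2] at h3
  have hs0 : 0 ≤ s := by positivity
  rcases hs0.eq_or_lt with h0 | h0
  · rw [← h0]
    simp
  · have h4 : κ * ‖centered u‖ ^ 2 ≤ s := by linarith
    have h5 : s ^ 2 ≤ ‖centered u‖ ^ 2 * ‖w‖ ^ 2 := by
      rw [← mul_pow]
      exact pow_le_pow_left₀ hs0 h3 2
    have h6 : κ * s * s ≤ ‖w‖ ^ 2 * s := by
      calc κ * s * s = κ * s ^ 2 := by ring
        _ ≤ κ * (‖centered u‖ ^ 2 * ‖w‖ ^ 2) := by gcongr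
        _ = κ * ‖centered u‖ ^ 2 * ‖w‖ ^ 2 := by ring
        _ ≤ s * ‖w‖ ^ 2 := by gcongr
        _ = ‖w‖ ^ 2 * s := by ring
    exact le_of_mul_le_mul_right h6 h0

theorem integral_sq_sum_three_sub {Ω : Type*} [MeasurableSpace Ω] {P : Measure Ω} (κ : ℝ)
    {u v w : Lp ℝ 2 P} {f g h : Ω → ℝ} (hu : u =ᵐ[P] f) (hv : v =ᵐ[P] g) (hw : w =ᵐ[P] h) :
    Integrable (fun η => (f η + g η + h η) ^ 2 - κ * (f η ^ 2 + g η ^ 2 + h η ^ 2)) P ∧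
    ∫ η, ((f η + g η + h η) ^ 2 - κ * (f η ^ 2 + g η ^ 2 + h η ^ 2)) ∂P =
      ‖u + v + w‖ ^ 2 - κ * (‖u‖ ^ 2 + ‖v‖ ^ 2 + ‖w‖ ^ 2) := by
  have hf := ((memLp_congr_ae hu).1 (Lp.memLp u))
  have hg := ((memLp_congr_ae hv).1 (Lp.memLp v))
  have hh := ((memLp_congr_ae hw).1 (Lp.memLp w))
  have hs : (u + v + w : Lp ℝ 2 P) =ᵐ[P] fun η => f η + g η + h η := by
    filter_upwards [hu, hv, hw, Lp.coeFn_add (u + v) w, Lp.coeFn_add u v] with η h1 h2 h3 h4 h5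
    rw [h4, Pi.add_apply, h5, Pi.add_apply, h1, h2, h3]
  have hi := ((memLp_congr_ae hs).1 (Lp.memLp _)).integrable_sq
  have hfg : Integrable (fun η => f η ^ 2 + g η ^ 2) P := hf.integrable_sq.add hg.integrable_sq
  have hi' : Integrable (fun η => κ * (f η ^ 2 + g η ^ 2 + h η ^ 2)) P :=
    (hfg.add hh.integrable_sq).const_mul κ
  refine ⟨hi.sub hi', ?_⟩
  rw [Lp_norm_sq_eq_integral hs, Lp_norm_sq_eq_integral hu, Lp_norm_sq_eq_integral hv,
    Lp_norm_sq_eq_integral hw, ← integral_add hf.integrable_sq hg.integrable_sq,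
    ← integral_add hfg hh.integrable_sq, ← integral_const_mul, ← integral_sub hi hi']

variable [Fintype ι] {P : Measure (ι → X)} {ω : Fin m → ℝ}

theorem IsGibbs.sub_pairProj_ae_eq (hP : IsGibbs hξ ν P ω) (hν : IsConditionedProduct μ ξ ν)
    {i j : ι} (h : i ≠ j) (u : Lp ℝ 2 P) :
    (u - pairProj P i j u : Lp ℝ 2 P) =ᵐ[P] fun η => u η - blockAvg ξ ν (pairEmb h) u η := by
  filter_upwards [Lp.coeFn_sub u (pairProj P i j u), hP.pairProj_ae_eq hν h u] with η h1 h2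
  rw [h1, Pi.sub_apply, h2]

/-- The inequality `A² ≥ κ A` for the three pairs of a triple of sites, obtained by
conditioning on the variables outside the triple. -/
theorem IsGibbs.norm_sq_triple_ge (hP : IsGibbs hξ ν P ω) (hν : IsConditionedProduct μ ξ ν)
    {κ : ℝ} (hκ : 0 < κ) (hgap : ∀ ω ∈ Theta ξ 3, ((κ / 3 : ℝ) : EReal) ≤ gapAvg ν 3 ω)
    {i j k : ι} (hij : i ≠ j) (hjk : j ≠ k) (hik : i ≠ k) (u : Lp ℝ 2 P) :
    κ * (‖u - pairProj P i j u‖ ^ 2 + ‖u - pairProj P j k u‖ ^ 2 + ‖u - pairProj P i k u‖ ^ 2) ≤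
      ‖(u - pairProj P i j u) + (u - pairProj P j k u) + (u - pairProj P i k u)‖ ^ 2 := by
  have := hP.prob
  have hu : Measurable (u : (ι → X) → ℝ) := (Lp.stronglyMeasurable u).measurable
  let e : Fin 3 ↪ ι := ⟨![i, j, k], by
    intro a b
    fin_cases a <;> fin_cases b <;> simp [hij, hjk, hik, hij.symm, hjk.symm, hik.symm]⟩
  have h01 : (0 : Fin 3) ≠ 1 := by decide
  have h12 : (1 : Fin 3) ≠ 2 := by decide
  have h02 : (0 : Fin 3) ≠ 2 := by decide
  have e01 : pairEmb hij = (pairEmb h01).trans e := by ext a; fin_cases a <;> rfl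
  have e12 : pairEmb hjk = (pairEmb h12).trans e := by ext a; fin_cases a <;> rfl
  have e02 : pairEmb hik = (pairEmb h02).trans e := by ext a; fin_cases a <;> rfl
  obtain ⟨hint, heq⟩ := integral_sq_sum_three_sub κ (hP.sub_pairProj_ae_eq hν hij u)
    (hP.sub_pairProj_ae_eq hν hjk u) (hP.sub_pairProj_ae_eq hν hik u)
  rw [← sub_nonneg, ← heq]
  have hm : ∀ b : Fin 2 ↪ ι, Measurable (blockAvg ξ ν b u) := fun b =>
    measurable_blockAvg hξ hν b hu
  have hm1 := hm (pairEmb hij)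
  have hm2 := hm (pairEmb hjk)
  have hm3 := hm (pairEmb hik)
  rw [← hP.integral_eq hν e (by fun_prop) hint]
  refine integral_nonneg_of_ae ?_
  filter_upwards [hP.ae_memLp hν e hu (Lp.memLp u)] with η hη
  have hΘ := blockSum_mem_Theta ξ e η
  have hP3 := hν.isGibbs hξ 3 hΘ
  have := hP3.prob
  have hum : Measurable fun ζ => u (Function.extend e ζ η) :=
    hu.comp (measurable_extend_right e η)
  have key : ∀ {a b : Fin 3} (h : a ≠ b), (hη.toLp - pairProj _ a b hη.toLp : Lp ℝ 2 _)
      =ᵐ[ν 3 (blockSum ξ e η)] fun ζ => u (Function.extend e ζ η) -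
        blockAvg ξ ν (pairEmb h) (fun ζ => u (Function.extend e ζ η)) ζ := fun {a b} h => by
    filter_upwards [Lp.coeFn_sub hη.toLp (pairProj _ a b hη.toLp), hη.coeFn_toLp,
      hP3.pairProj_toLp hν h hum hη] with ζ h1 h2 h3
    rw [h1, Pi.sub_apply, h2, h3]
  have h3 := (integral_sq_sum_three_sub κ (key h01) (key h12) (key h02)).2
  rw [Pi.zero_apply, blockAvg]
  simp only [e01, e12, e02, blockAvg_trans_extend]
  rw [h3, sub_nonneg]
  exact norm_sq_sum_three_ge hκ (hgap _ hΘ) _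

end MeanField

section CompleteGraph

theorem sum_sum_eq_two_mul_sum_completePairs {N : ℕ} {F : Fin N → Fin N → ℝ}
    (h0 : ∀ i, F i i = 0) (hsymm : ∀ i j, F i j = F j i) :
    ∑ i, ∑ j, F i j = 2 * ∑ b ∈ completePairs N, F b.1 b.2 := by
  have h1 : ∑ b ∈ completePairs N, F b.1 b.2 = ∑ i, ∑ j, if i < j then F i j else 0 := by
    rw [completePairs, Finset.sum_filter, Fintype.sum_prod_type]
  have h2 : ∑ b ∈ completePairs N, F b.1 b.2 = ∑ i, ∑ j, if j < i then F i j else 0 := by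
    rw [h1, Finset.sum_comm]
    simp_rw [hsymm]
  rw [two_mul]
  nth_rewrite 1 [h1]
  rw [h2]
  simp_rw [← Finset.sum_add_distrib]
  refine Finset.sum_congr rfl fun i _ => Finset.sum_congr rfl fun j _ => ?_
  rcases lt_trichotomy i j with h | rfl | h
  · simp [h, h.not_gt]
  · simp [h0]
  · simp [h, h.not_gt]

variable {X : Type*} [MeasurableSpace X] {m : ℕ} {μ : Measure X} {ξ : X → Fin m → ℝ}
  {ν : ∀ N : ℕ, Kernel (Fin m → ℝ) (Fin N → X)} {ω : Fin m → ℝ}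

/-- The spectral gap of the averaging process on the complete graph with `N` sites, from the gap
for three sites and ergodicity. -/
theorem mul_norm_sq_le_sum_completePairs_of_ergodic (hξ : Measurable ξ)
    (hν : IsConditionedProduct μ ξ ν) {κ : ℝ} (hκ : 1 < κ)
    (hgap : ∀ ω ∈ Theta ξ 3, ((κ / 3 : ℝ) : EReal) ≤ gapAvg ν 3 ω) {N : ℕ} (hN : 2 ≤ N)
    (hω : ω ∈ Theta ξ N) (hErg : IsErgodicAvg ν N ω) (u : Lp ℝ 2 (ν N ω))
    (hu : ∫ η, u η ∂(ν N ω) = 0) :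
    (1 + (κ - 1) * ((N : ℝ) - 2)) * ‖u‖ ^ 2 ≤
      ∑ b ∈ completePairs N, ‖u - pairProj (ν N ω) b.1 b.2 u‖ ^ 2 := by
  have hP := hν.isGibbs hξ N hω
  have := hP.prob
  let D : Fin N → Fin N → Lp ℝ 2 (ν N ω) →L[ℝ] Lp ℝ 2 (ν N ω) := fun i j =>
    if i = j then 0 else ContinuousLinearMap.id ℝ _ - pairProj (ν N ω) i j
  have hDself : ∀ i v, D i i v = 0 := fun i v => by simp [D]
  have hDne : ∀ {i j}, i ≠ j → ∀ v, D i j v = v - pairProj (ν N ω) i j v := fun {i j} h v => by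
    simp [D, h]
  have hDsymm : ∀ i j v, D i j v = D j i v := fun i j v => by
    by_cases h : i = j
    · rw [h]
    · rw [hDne h, hDne (Ne.symm h), hP.pairProj_symm hν h]
  have hDinner : ∀ i j v w, inner ℝ (D i j v) w = inner ℝ v (D i j w) := fun i j v w => by
    by_cases h : i = j
    · subst h; simp [hDself]
    · rw [hDne h, hDne h, inner_sub_left, inner_sub_right, inner_pairProj_left]
  have hDsq : ∀ i j v, ‖D i j v‖ ^ 2 = inner ℝ v (D i j v) := fun i j v => by
    by_cases h : i = j
    · subst h; simp [hDself]
    · rw [hDne h, norm_sub_pairProj_sq]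
  have hDD : ∀ i j v, D i j (D i j v) = D i j v := fun i j v => by
    by_cases h : i = j
    · subst h; simp [hDself]
    · rw [hDne h, hDne h, map_sub, pairProj_pairProj, sub_self, sub_zero]
  let A : Lp ℝ 2 (ν N ω) →L[ℝ] Lp ℝ 2 (ν N ω) := ∑ i, ∑ j, D i j
  have hA : ∀ v, A v = ∑ i, ∑ j, D i j v := fun v => by
    simp [A]
  have hAinner : ∀ v, inner ℝ v (A v) = ∑ i, ∑ j, ‖D i j v‖ ^ 2 := fun v => by
    simp only [hA, inner_sum, hDsq]
  have hsum : ∀ v, ∑ i, ∑ j, ‖D i j v‖ ^ 2 =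
      2 * ∑ b ∈ completePairs N, ‖v - pairProj (ν N ω) b.1 b.2 v‖ ^ 2 := fun v => by
    rw [sum_sum_eq_two_mul_sum_completePairs (F := fun i j => ‖D i j v‖ ^ 2)
      (fun i => by simp [hDself]) (fun i j => by rw [hDsymm])]
    congr 1
    refine Finset.sum_congr rfl fun b hb => ?_
    rw [hDne (Finset.mem_filter.1 hb).2.ne]
  have hN' : (2 : ℝ) ≤ N := by exact_mod_cast hN
  have hc : 0 ≤ (κ - 1) * ((N : ℝ) - 2) := mul_nonneg (by linarith) (by linarith)
  have key := mul_norm_sq_le_inner_of_mul_inner_le_norm_sq A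
    (c := 2 * (1 + (κ - 1) * ((N : ℝ) - 2))) (f := u)
    (fun v w => by simp only [hA, sum_inner, inner_sum, hDinner])
    (fun v => by rw [hAinner]; positivity) (by linarith) (fun v => by
      rw [hAinner, hA]
      have h := norm_sq_sum_pairs_ge (fun i j => D i j v) (κ := κ) (fun i => hDself i v)
        (fun i j => hDsymm i j v) (fun i j k l hij hkl hik hil hjk hjl => by
          -- the two projections commute, so their product is a projection
          have hcomm : ∀ w, D i j (D k l w) = D k l (D i j w) := fun w => by
            simp only [hDne hij, hDne hkl, map_sub, hP.pairProj_comm hν hij hkl hik hil hjk hjl]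
            abel
          have h1 : inner ℝ (D i j v) (D k l v) = ‖D i j (D k l v)‖ ^ 2 := by
            rw [hDsq i j (D k l v), hDinner k l v, ← hcomm, hDD k l v, hDinner i j v]
          rw [h1]
          positivity)
        (fun i j k hij hjk hik => by
          simp only [hDne hij, hDne hjk, hDne hik]
          exact hP.norm_sq_triple_ge hν (by linarith) hgap hij hjk hik v)
      rwa [Fintype.card_fin] at h)
    (fun v hv => by
      have h0 : ∑ i, ∑ j, ‖D i j v‖ ^ 2 = 0 := by rw [← hAinner, hv, inner_zero_right]
      have h1 : ∀ i j, i < j → (ν N ω)[v | outsideSigma i j] =ᵐ[ν N ω] v := fun i j hij => by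
        have h2 := (Finset.sum_eq_zero_iff_of_nonneg fun i _ =>
          Finset.sum_nonneg fun j _ => sq_nonneg ‖D i j v‖).1 h0 i (Finset.mem_univ i)
        have h3 := (Finset.sum_eq_zero_iff_of_nonneg fun j _ =>
          sq_nonneg ‖D i j v‖).1 h2 j (Finset.mem_univ j)
        rw [sq_eq_zero_iff, norm_eq_zero, hDne hij.ne, sub_eq_zero] at h3
        have h4 := pairProj_ae_eq_condExp i j (Lp.memLp v)
        rw [Lp.toLp_coeFn, ← h3] at h4
        exact h4.symm
      obtain ⟨a, ha⟩ := hErg v (Lp.memLp v) h1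
      rw [Lp_inner_eq_integral ha (.refl _ _), integral_const_mul, hu, mul_zero])
  rw [hAinner, hsum] at key
  linarith

/-- For two sites the average over the pair is the mean. -/
theorem pairProj_two_eq_zero (hξ : Measurable ξ) (hν : IsConditionedProduct μ ξ ν)
    (hω : ω ∈ Theta ξ 2) (u : Lp ℝ 2 (ν 2 ω)) (hu : ∫ η, u η ∂(ν 2 ω) = 0) :
    pairProj (ν 2 ω) 0 1 u = 0 := by
  have hP := hν.isGibbs hξ 2 hω
  have h01 : (0 : Fin 2) ≠ 1 := by decide
  refine Lp.ext ((hP.pairProj_ae_eq hν h01 u).trans ?_)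
  filter_upwards [hP.sum_eq, Lp.coeFn_zero ℝ 2 (ν 2 ω)] with η h1 h2
  have h3 : blockSum ξ (pairEmb h01) η = ω := by
    rw [← h1, blockSum, Fin.sum_univ_two, Fin.sum_univ_two]
    rfl
  have h4 : ∀ ζ : Fin 2 → X, Function.extend (pairEmb h01) ζ η = ζ := fun ζ => by
    funext a
    have : a = pairEmb h01 a := by fin_cases a <;> rfl
    rw [this, (pairEmb h01).injective.extend_apply, ← this]
  rw [h2, blockAvg, h3]
  simp only [h4, hu, Pi.zero_apply]

theorem completePairs_two : completePairs 2 = {(0, 1)} := by decide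

/-- The mean-field Poincaré inequality, uniformly in the number of sites and in the value of the
conserved quantity. -/
theorem mul_norm_sq_le_sum_completePairs (hξ : Measurable ξ)
    (hν : IsConditionedProduct μ ξ ν) {κ δ : ℝ} (hδκ : δ ≤ κ - 1) (hδ : 0 < δ) (hδ2 : δ ≤ 1 / 2)
    (hgap : ∀ ω ∈ Theta ξ 3, ((κ / 3 : ℝ) : EReal) ≤ gapAvg ν 3 ω)
    (hErg : ∀ N : ℕ, 4 ≤ N → ∀ ω ∈ Theta ξ N, IsErgodicAvg ν N ω) {N : ℕ} (hN : 2 ≤ N)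
    (hω : ω ∈ Theta ξ N) (u : Lp ℝ 2 (ν N ω)) (hu : ∫ η, u η ∂(ν N ω) = 0) :
    δ * N * ‖u‖ ^ 2 ≤ ∑ b ∈ completePairs N, ‖u - pairProj (ν N ω) b.1 b.2 u‖ ^ 2 := by
  have hN' : (2 : ℝ) ≤ N := by exact_mod_cast hN
  suffices h : (1 + (κ - 1) * ((N : ℝ) - 2)) * ‖u‖ ^ 2 ≤
      ∑ b ∈ completePairs N, ‖u - pairProj (ν N ω) b.1 b.2 u‖ ^ 2 by
    refine le_trans ?_ h
    gcongr
    -- `δ N ≤ 1 + δ (N - 2)`, as `δ ≤ 1 / 2`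
    nlinarith
  have hκ : 1 < κ := by linarith
  have hprob := (hν.isGibbs hξ N hω).prob
  obtain rfl | rfl | h4 : N = 2 ∨ N = 3 ∨ 4 ≤ N := by omega
  · rw [completePairs_two, Finset.sum_singleton, pairProj_two_eq_zero hξ hν hω u hu]
    simp
  · have h := (le_gap_isAverageGen_iff _ _ _).1 (hgap ω hω) u hu
    push_cast at h ⊢
    linarith
  · exact mul_norm_sq_le_sum_completePairs_of_ergodic hξ hν hκ hgap hN hω (hErg N h4 ω hω) u hu

end CompleteGraph

/-! ### Paths in the cube -/

section Paths

/-- Iteration of the inequality `a x z ≤ 2 * a x y + a y z`, which loses the factor two only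
once. -/
theorem le_two_mul_sum_path {V : Type*} {a : V → V → ℝ} (h0 : ∀ x, a x x = 0)
    (htri : ∀ x y z, a x z ≤ 2 * a x y + a y z) (n : ℕ) (p : ℕ → V) :
    a (p 0) (p n) ≤ 2 * ∑ i ∈ Finset.range n, a (p i) (p (i + 1)) := by
  induction n generalizing p with
  | zero => simp [h0]
  | succ n ih =>
    have h1 := htri (p 0) (p 1) (p (n + 1))
    have h2 := ih fun i => p (i + 1)
    rw [Finset.sum_range_succ']
    simp only [zero_add] at h2 ⊢
    linarith

variable {d N : ℕ}

/-- The next site on a line, with the last site as its own successor. -/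
def nextSite (r : Fin N) : Fin N := if h : (r : ℕ) + 1 < N then ⟨r + 1, h⟩ else r

/-- The neighbour of `w` in the direction `j`; `w` itself on the upper face of the cube. -/
def neighbour (j : Fin d) (w : Fin d → Fin N) : Fin d → Fin N :=
  Function.update w j (nextSite (w j))

theorem le_two_mul_sum_line {a : (Fin d → Fin N) → (Fin d → Fin N) → ℝ} (ha : ∀ x y, 0 ≤ a x y)
    (h0 : ∀ x, a x x = 0) (hsymm : ∀ x y, a x y = a y x)
    (htri : ∀ x y z, a x z ≤ 2 * a x y + a y z) (j : Fin d) (w : Fin d → Fin N) (s t : Fin N) :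
    a (Function.update w j s) (Function.update w j t) ≤
      2 * ∑ r, a (Function.update w j r) (neighbour j (Function.update w j r)) := by
  wlog hst : s ≤ t generalizing s t
  · rw [hsymm]
    exact this t s (le_of_not_ge hst)
  let p : ℕ → Fin d → Fin N := fun r =>
    if h : (s : ℕ) + r < N then Function.update w j ⟨s + r, h⟩ else w
  have hst' : (s : ℕ) ≤ t := hst
  have ht := t.2
  have hp0 : p 0 = Function.update w j s := by simp [p]
  have hpt : p (t - s) = Function.update w j t := by
    have h1 : (s : ℕ) + (t - s) = t := by omega
    simp [p, h1]
  have h := le_two_mul_sum_path h0 htri (t - s) p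
  rw [hp0, hpt] at h
  refine h.trans ?_
  gcongr
  have h2 : ∀ i ∈ Finset.range ((t : ℕ) - s), a (p i) (p (i + 1)) =
      (fun r : ℕ => if h : r < N then a (Function.update w j ⟨r, h⟩)
        (neighbour j (Function.update w j ⟨r, h⟩)) else 0) (s + i) := fun i hi => by
    have hi' := Finset.mem_range.1 hi
    have h3 : (s : ℕ) + i < N := by omega
    have h4 : (s : ℕ) + (i + 1) < N := by omega
    simp [p, h3, h4, neighbour, nextSite, add_assoc]
  rw [Finset.sum_congr rfl h2]
  rw [← Finset.sum_image (s := Finset.range ((t : ℕ) - s)) (g := fun i => (s : ℕ) + i)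
    (f := fun r : ℕ => if h : r < N then a (Function.update w j ⟨r, h⟩)
        (neighbour j (Function.update w j ⟨r, h⟩)) else 0)
    (fun x _ y _ hxy => Nat.add_left_cancel hxy)]
  have h6 : ∑ r : Fin N, a (Function.update w j r) (neighbour j (Function.update w j r)) =
      ∑ r ∈ Finset.range N, if h : r < N then a (Function.update w j ⟨r, h⟩)
        (neighbour j (Function.update w j ⟨r, h⟩)) else 0 := by
    rw [Finset.sum_range]
    simp
  rw [h6]
  refine Finset.sum_le_sum_of_subset_of_nonneg (fun r hr => ?_) fun r _ _ => ?_
  · obtain ⟨i, hi, rfl⟩ := Finset.mem_image.1 hr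
    have := Finset.mem_range.1 hi
    exact Finset.mem_range.2 (by omega)
  · split_ifs
    · exact ha _ _
    · exact le_rfl

/-- The point whose coordinates before `j` are those of `y`, and the others those of `x`. -/
def splice (j : ℕ) (x y : Fin d → Fin N) : Fin d → Fin N :=
  fun i => if (i : ℕ) < j then y i else x i

/-- The map `(x, y) ↦ (splice j x y, splice j y x)` is an involution, so that `splice j` takes each
value equally often. -/
theorem sum_sum_splice (j : ℕ) (G : (Fin d → Fin N) → ℝ) :
    ∑ x, ∑ y, G (splice j x y) = (N : ℝ) ^ d * ∑ w, G w := by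
  have hinv : Function.Involutive fun p : (Fin d → Fin N) × (Fin d → Fin N) =>
      (splice j p.1 p.2, splice j p.2 p.1) := by
    rintro ⟨x, y⟩
    ext i <;> by_cases h : (i : ℕ) < j <;> simp [splice, h]
  rw [← Fintype.sum_prod_type', ← Equiv.sum_comp hinv.toPerm, Fintype.sum_prod_type]
  have h : ∀ x y : Fin d → Fin N, splice j (splice j x y) (splice j y x) = x := fun x y =>
    congrArg Prod.fst (hinv (x, y))
  simp only [Function.Involutive.coe_toPerm, h, Finset.sum_const, Finset.card_univ,
    Fintype.card_pi, Fintype.card_fin, Finset.prod_const, nsmul_eq_mul, Nat.cast_pow,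
    ← Finset.mul_sum]

/-- The exchange of `r` with the `j`-th coordinate of `w` is an involution of the pairs `(w, r)`. -/
theorem sum_sum_update (j : Fin d) (G : (Fin d → Fin N) → ℝ) :
    ∑ w, ∑ r, G (Function.update w j r) = N * ∑ w, G w := by
  have hinv : Function.Involutive fun p : (Fin d → Fin N) × Fin N =>
      (Function.update p.1 j p.2, p.1 j) := by
    rintro ⟨w, r⟩
    simp
  rw [← Fintype.sum_prod_type', ← Equiv.sum_comp hinv.toPerm, Fintype.sum_prod_type]
  simp only [Function.Involutive.coe_toPerm, Function.update_idem, Function.update_eq_self,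
    Finset.sum_const, Finset.card_univ, Fintype.card_fin, nsmul_eq_mul, ← Finset.mul_sum]

theorem neighbour_mem_cubePairs (j : Fin d) (w : Fin d → Fin N) (h : (w j : ℕ) + 1 < N) :
    (w, neighbour j w) ∈ cubePairs d N := by
  have hn : nextSite (w j) = ⟨w j + 1, h⟩ := dif_pos h
  simp only [cubePairs, Finset.mem_filter, Finset.mem_univ, true_and]
  refine ⟨fun k => ?_, ?_⟩
  · by_cases hk : k = j
    · subst hk
      simp only [neighbour, Function.update_self, hn, Fin.le_def]
      omega
    · simp [neighbour, hk]
  · rw [Finset.sum_eq_single j]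
    · simp [neighbour, hn]
    · intro k _ hk
      simp [neighbour, hk]
    · simp

/-- Each nearest-neighbour pair is `(w, neighbour j w)` for one direction `j`; the sites on
the upper faces contribute zero. -/
theorem sum_neighbour_le_sum_cubePairs {F : (Fin d → Fin N) → (Fin d → Fin N) → ℝ}
    (hF : ∀ x y, 0 ≤ F x y) (h0 : ∀ x, F x x = 0) :
    ∑ j, ∑ w, F w (neighbour j w) ≤ ∑ b ∈ cubePairs d N, F b.1 b.2 := by
  classical
  rw [← Fintype.sum_prod_type' (f := fun j w => F w (neighbour j w))]
  rw [← Finset.sum_filter_add_sum_filter_not _ fun p : Fin d × (Fin d → Fin N) =>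
    (p.2 p.1 : ℕ) + 1 < N]
  have h1 : ∑ p : Fin d × (Fin d → Fin N) with ¬ (p.2 p.1 : ℕ) + 1 < N,
      F p.2 (neighbour p.1 p.2) = 0 := by
    refine Finset.sum_eq_zero fun p hp => ?_
    have hp' : ¬ (p.2 p.1 : ℕ) + 1 < N := (Finset.mem_filter.1 hp).2
    simp only [neighbour, nextSite, hp', dif_neg, not_false_eq_true, Function.update_eq_self, h0]
  rw [h1, add_zero]
  rw [← Finset.sum_image (g := fun p : Fin d × (Fin d → Fin N) => (p.2, neighbour p.1 p.2))
    (f := fun b : (Fin d → Fin N) × (Fin d → Fin N) => F b.1 b.2)]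
  · refine Finset.sum_le_sum_of_subset_of_nonneg (fun b hb => ?_) fun b _ _ => hF _ _
    obtain ⟨p, hp, rfl⟩ := Finset.mem_image.1 hb
    exact neighbour_mem_cubePairs _ _ (Finset.mem_filter.1 hp).2
  · rintro ⟨j, w⟩ hp ⟨j', w'⟩ - heq
    simp only [Prod.mk.injEq] at heq
    obtain ⟨rfl, heq⟩ := heq
    have hp' : (w j : ℕ) + 1 < N := (Finset.mem_filter.1 hp).2
    by_contra hne
    have hj : j ≠ j' := fun h => hne (by rw [h])
    have h2 := congrArg (fun v => ((v j : Fin N) : ℕ)) heq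
    simp [neighbour, nextSite, hj, hp'] at h2

/-- Comparison of the complete graph on the cube with the nearest-neighbour graph, along the
paths that change one coordinate after the other. -/
theorem sum_sum_sq_le_sum_cubePairs {a : (Fin d → Fin N) → (Fin d → Fin N) → ℝ}
    (ha : ∀ x y, 0 ≤ a x y) (h0 : ∀ x, a x x = 0) (hsymm : ∀ x y, a x y = a y x)
    (htri : ∀ x y z, a x z ≤ 2 * a x y + a y z) :
    ∑ x, ∑ y, a x y ^ 2 ≤ 16 * d * (N : ℝ) ^ (d + 2) * ∑ b ∈ cubePairs d N, a b.1 b.2 ^ 2 := by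
  let A : Fin d → (Fin d → Fin N) → ℝ := fun j w => a w (neighbour j w)
  have h1 : ∀ x y, a x y ≤ 4 * ∑ j : Fin d, ∑ r, A j (Function.update (splice j x y) j r) := by
    intro x y
    have h := le_two_mul_sum_path h0 htri d fun j => splice j x y
    have hs0 : splice 0 x y = x := by ext i; simp [splice]
    have hsd : splice d x y = y := by ext i; simp [splice]
    simp only [hs0, hsd, Finset.sum_range] at h
    refine h.trans ?_
    rw [show (4 : ℝ) = 2 * 2 by norm_num, mul_assoc]
    refine mul_le_mul_of_nonneg_left ?_ (zero_le_two : (0 : ℝ) ≤ 2)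
    rw [Finset.mul_sum]
    refine Finset.sum_le_sum fun (j : Fin d) _ => ?_
    have e1 : splice j x y = Function.update (splice j x y) j (x j) := by
      ext i
      by_cases hi : i = j
      · subst hi; simp [splice]
      · simp [hi]
    have e2 : splice (j + 1) x y = Function.update (splice j x y) j (y j) := by
      ext i
      by_cases hi : i = j
      · subst hi; simp [splice]
      · have : (i : ℕ) ≠ j := fun h => hi (Fin.ext h)
        have : (i : ℕ) < j + 1 ↔ (i : ℕ) < j := by omega
        simp [hi, splice, this]
    calc a (splice j x y) (splice (j + 1) x y)
        = a (Function.update (splice j x y) j (x j)) (Function.update (splice j x y) j (y j)) := by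
          rw [← e1, e2]
      _ ≤ _ := le_two_mul_sum_line ha h0 hsymm htri j _ _ _
  have h2 : ∀ x y, a x y ^ 2 ≤
      16 * d * N * ∑ j : Fin d, ∑ r, A j (Function.update (splice j x y) j r) ^ 2 := by
    intro x y
    calc a x y ^ 2 ≤ (4 * ∑ j : Fin d, ∑ r, A j (Function.update (splice j x y) j r)) ^ 2 :=
          pow_le_pow_left₀ (ha x y) (h1 x y) 2
      _ = 16 * (∑ j : Fin d, ∑ r, A j (Function.update (splice j x y) j r)) ^ 2 := by ring
      _ ≤ 16 * (d * ∑ j : Fin d, (∑ r, A j (Function.update (splice j x y) j r)) ^ 2) := by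
          gcongr
          simpa using sq_sum_le_card_mul_sum_sq (s := (Finset.univ : Finset (Fin d)))
            (f := fun j => ∑ r, A j (Function.update (splice j x y) j r))
      _ ≤ 16 * (d * ∑ j : Fin d, (N * ∑ r, A j (Function.update (splice j x y) j r) ^ 2)) := by
          gcongr with j
          simpa using sq_sum_le_card_mul_sum_sq (s := (Finset.univ : Finset (Fin N)))
            (f := fun r => A j (Function.update (splice j x y) j r))
      _ = _ := by rw [← Finset.mul_sum]; ring
  have h3 : ∀ j : Fin d, ∑ x, ∑ y, ∑ r, A j (Function.update (splice j x y) j r) ^ 2 =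
      (N : ℝ) ^ (d + 1) * ∑ w, A j w ^ 2 := fun j => by
    rw [sum_sum_splice j fun w => ∑ r, A j (Function.update w j r) ^ 2,
      sum_sum_update j fun w => A j w ^ 2]
    ring
  calc ∑ x, ∑ y, a x y ^ 2
      ≤ ∑ x, ∑ y, 16 * d * N * ∑ j : Fin d, ∑ r, A j (Function.update (splice j x y) j r) ^ 2 :=
        Finset.sum_le_sum fun x _ => Finset.sum_le_sum fun y _ => h2 x y
    _ = 16 * d * N * ∑ j : Fin d, ∑ x, ∑ y, ∑ r,
          A j (Function.update (splice j x y) j r) ^ 2 := by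
        simp_rw [← Finset.mul_sum]
        congr 1
        rw [Finset.sum_congr rfl fun x _ => Finset.sum_comm, Finset.sum_comm]
    _ = 16 * d * (N : ℝ) ^ (d + 2) * ∑ j, ∑ w, A j w ^ 2 := by
        simp_rw [h3, ← Finset.mul_sum]
        ring
    _ ≤ _ := by
        gcongr
        exact sum_neighbour_le_sum_cubePairs (F := fun x y => a x y ^ 2)
          (fun x y => sq_nonneg _) fun x => by simp [h0]

end Paths

/-! ### Exchanges of variables and the local averaging process -/

section Local

variable {X : Type*} {ι ι' : Type*}

theorem swap_trans_pairEmb [DecidableEq ι] {i j : ι} (h : i ≠ j) :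
    (Equiv.swap (0 : Fin 2) 1).toEmbedding.trans (pairEmb h) =
      (pairEmb h).trans (Equiv.swap i j).toEmbedding := by
  ext a
  fin_cases a
  · exact (Equiv.swap_apply_left i j).symm
  · exact (Equiv.swap_apply_right i j).symm

theorem extend_pairEmb_comp_swap [DecidableEq ι] {i j : ι} (h : i ≠ j) (ζ : Fin 2 → X) (η : ι → X) :
    Function.extend (pairEmb h) ζ η ∘ Equiv.swap i j =
      Function.extend (pairEmb h) (ζ ∘ Equiv.swap 0 1) η := by
  have h1 := extend_trans_perm (Equiv.swap 0 1) (pairEmb h) ζ (η ∘ Equiv.swap i j)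
  rw [swap_trans_pairEmb] at h1
  rw [extend_comp_equiv, Equiv.symm_swap, h1, Equiv.symm_swap]
  refine extend_congr _ _ fun l hl => ?_
  rw [Function.comp_apply, Equiv.swap_apply_of_ne_of_ne]
  · rintro rfl
    exact hl ⟨0, rfl⟩
  · rintro rfl
    exact hl ⟨1, rfl⟩

variable [MeasurableSpace X] {P : Measure (ι → X)}

theorem norm_sub_pairProj_le (i j : ι) (u : Lp ℝ 2 P) : ‖u - pairProj P i j u‖ ≤ ‖u‖ := by
  have h1 := norm_sub_pairProj_sq i j u
  have h2 := real_inner_le_norm u (u - pairProj P i j u)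
  rw [← h1, sq] at h2
  by_contra! h
  have h3 : 0 < ‖u - pairProj P i j u‖ := (norm_nonneg u).trans_lt h
  nlinarith

section

variable [DecidableEq ι]

/-- The `L²` distance from `u` to its average over the pair `i, j`; zero if `i = j`. -/
def pairDist (u : Lp ℝ 2 P) (i j : ι) : ℝ :=
  if i = j then 0 else ‖u - pairProj P i j u‖

theorem pairDist_nonneg (u : Lp ℝ 2 P) (i j : ι) : 0 ≤ pairDist u i j := by
  unfold pairDist
  split_ifs <;> positivity

theorem pairDist_self (u : Lp ℝ 2 P) (i : ι) : pairDist u i i = 0 := if_pos rfl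

theorem pairDist_of_ne (u : Lp ℝ 2 P) {i j : ι} (h : i ≠ j) :
    pairDist u i j = ‖u - pairProj P i j u‖ := if_neg h

end

variable {m : ℕ} [Fintype ι] [Fintype ι']
  {μ : Measure X} {ξ : X → Fin m → ℝ} {hξ : Measurable ξ}
  {ν : ∀ N : ℕ, Kernel (Fin m → ℝ) (Fin N → X)} {P' : Measure (ι' → X)}
  {ω ω' : Fin m → ℝ}

/-- Relabelling the sites of `u` and averaging over `i, j` is averaging over the sites with these
new labels and then relabelling. -/
theorem IsGibbs.pairProj_compMeasurePreserving (hP : IsGibbs hξ ν P ω) (hP' : IsGibbs hξ ν P' ω')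
    (hν : IsConditionedProduct μ ξ ν) (τ : ι' ≃ ι)
    (hτ : MeasurePreserving (fun η : ι → X => η ∘ τ) P P') {i j : ι} (h : i ≠ j)
    (u : Lp ℝ 2 P') :
    pairProj P i j (Lp.compMeasurePreserving _ hτ u) =
      Lp.compMeasurePreserving _ hτ (pairProj P' (τ.symm i) (τ.symm j) u) := by
  have h' : τ.symm i ≠ τ.symm j := τ.symm.injective.ne h
  refine Lp.ext ?_
  have h1 := hτ.quasiMeasurePreserving.ae (hP'.pairProj_ae_eq hν h' u)
  have h2 := hP.blockAvg_congr hν (pairEmb h) (Lp.coeFn_compMeasurePreserving u hτ)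
  have he : (pairEmb h).trans τ.symm.toEmbedding = pairEmb h' := by
    ext a; fin_cases a <;> rfl
  filter_upwards [hP.pairProj_ae_eq hν h (Lp.compMeasurePreserving _ hτ u), h1, h2,
    Lp.coeFn_compMeasurePreserving (pairProj P' (τ.symm i) (τ.symm j) u) hτ] with η e1 e2 e3 e4
  rw [e1, e3, e4, Function.comp_apply, e2, ← he]
  exact blockAvg_comp_equiv τ (pairEmb h) u η

variable [DecidableEq ι]

/-- A Gibbs measure is invariant under the exchange of two variables, because the average over
them is. -/
theorem IsGibbs.measurePreserving_swap (hP : IsGibbs hξ ν P ω) (hν : IsConditionedProduct μ ξ ν)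
    {i j : ι} (h : i ≠ j) :
    MeasurePreserving (fun η : ι → X => η ∘ Equiv.swap i j) P P := by
  have hm : Measurable fun η : ι → X => η ∘ Equiv.swap i j := by fun_prop
  have hm2 : Measurable fun ζ : Fin 2 → X => ζ ∘ Equiv.swap 0 1 := by fun_prop
  refine ⟨hm, ?_⟩
  ext S hS
  rw [Measure.map_apply hm hS]
  conv_rhs => rw [← hP.invariant 2 (pairEmb h), Measure.bind_apply hS (Kernel.aemeasurable _)]
  conv_lhs => rw [← hP.invariant 2 (pairEmb h), Measure.bind_apply (hm hS) (Kernel.aemeasurable _)]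
  refine lintegral_congr fun η => ?_
  have hme := measurable_extend_right (X := X) (pairEmb h) η
  rw [resample_apply hξ hν, Measure.map_apply hme (hm hS), Measure.map_apply hme hS]
  conv_rhs => rw [← hν.map_perm (blockSum_mem_Theta ξ (pairEmb h) η) (Equiv.swap 0 1),
    Measure.map_apply hm2 (hme hS)]
  congr 1
  ext ζ
  simp only [Set.mem_preimage, extend_pairEmb_comp_swap]

theorem IsGibbs.pairProj_swap (hP : IsGibbs hξ ν P ω) (hν : IsConditionedProduct μ ξ ν)
    {i j : ι} (h : i ≠ j) (u : Lp ℝ 2 P) :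
    pairProj P i j (Lp.compMeasurePreserving _ (hP.measurePreserving_swap hν h) u) =
      pairProj P i j u := by
  refine Lp.ext ((hP.pairProj_ae_eq hν h _).trans (.trans ?_ (hP.pairProj_ae_eq hν h u).symm))
  refine (hP.blockAvg_congr hν (pairEmb h)
    (Lp.coeFn_compMeasurePreserving u (hP.measurePreserving_swap hν h))).trans
    (ae_of_all _ fun η => ?_)
  have h1 := blockAvg_comp_equiv (ξ := ξ) (ν := ν) (Equiv.swap i j) (pairEmb h) u η
  have hm2 : Measurable fun ζ : Fin 2 → X => ζ ∘ Equiv.swap 0 1 := by fun_prop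
  have hfe : Measurable fun ζ => u (Function.extend (pairEmb h) ζ η) :=
    (Lp.stronglyMeasurable u).measurable.comp (measurable_extend_right _ η)
  simp only [blockAvg, Function.comp_apply, extend_pairEmb_comp_swap]
  conv_rhs => rw [← hν.map_perm (blockSum_mem_Theta ξ (pairEmb h) η) (Equiv.swap 0 1)]
  rw [integral_map hm2.aemeasurable hfe.aestronglyMeasurable]

theorem IsGibbs.pairDist_symm (hP : IsGibbs hξ ν P ω) (hν : IsConditionedProduct μ ξ ν)
    (u : Lp ℝ 2 P) (i j : ι) : pairDist u i j = pairDist u j i := by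
  by_cases h : i = j
  · rw [h]
  · rw [pairDist_of_ne u h, pairDist_of_ne u (Ne.symm h), hP.pairProj_symm hν h]

/-- The exchange of two variables moves `u` by at most twice its distance to the average. -/
theorem IsGibbs.norm_sub_swap_le (hP : IsGibbs hξ ν P ω) (hν : IsConditionedProduct μ ξ ν)
    {i j : ι} (h : i ≠ j) (u : Lp ℝ 2 P) :
    ‖u - Lp.compMeasurePreserving _ (hP.measurePreserving_swap hν h) u‖ ≤
      2 * ‖u - pairProj P i j u‖ := by
  set T := Lp.compMeasurePreserving (E := ℝ) (p := 2) _ (hP.measurePreserving_swap hν h) with hT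
  have h1 : T (pairProj P i j u) = pairProj P i j u := by
    have h2 := hP.pairProj_compMeasurePreserving hP hν (Equiv.swap i j)
      (hP.measurePreserving_swap hν h) h u
    rw [hP.pairProj_swap hν h, Equiv.symm_swap, Equiv.swap_apply_left, Equiv.swap_apply_right,
      ← hP.pairProj_symm hν h] at h2
    exact h2.symm
  have h3 : u - T u = (u - pairProj P i j u) - T (u - pairProj P i j u) := by
    rw [map_sub, h1]
    abel
  rw [h3]
  refine (norm_sub_le _ _).trans ?_
  rw [hT, Lp.norm_compMeasurePreserving, two_mul]

/-- Exchanging `x` and `y` turns the average over `x, z` into the average over `y, z`. -/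
theorem IsGibbs.pairDist_triangle (hP : IsGibbs hξ ν P ω) (hν : IsConditionedProduct μ ξ ν)
    (u : Lp ℝ 2 P) (x y z : ι) : pairDist u x z ≤ 2 * pairDist u x y + pairDist u y z := by
  by_cases hxz : x = z
  · rw [hxz, pairDist_self]
    have := pairDist_nonneg u z y
    have := pairDist_nonneg u y z
    positivity
  by_cases hxy : x = y
  · rw [hxy, pairDist_self]
    simp
  by_cases hyz : y = z
  · rw [hyz, pairDist_self]
    linarith [pairDist_nonneg u x z]
  set T := Lp.compMeasurePreserving (E := ℝ) (p := 2) _ (hP.measurePreserving_swap hν hxy) with hT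
  have h1 : pairProj P x z (T u) = T (pairProj P y z u) := by
    have h2 := hP.pairProj_compMeasurePreserving hP hν (Equiv.swap x y)
      (hP.measurePreserving_swap hν hxy) hxz u
    rwa [Equiv.symm_swap, Equiv.swap_apply_left,
      Equiv.swap_apply_of_ne_of_ne (Ne.symm hxz) (Ne.symm hyz)] at h2
  rw [pairDist_of_ne u hxz, pairDist_of_ne u hxy, pairDist_of_ne u hyz]
  have h3 : u - pairProj P x z u =
      ((u - T u) - pairProj P x z (u - T u)) + T (u - pairProj P y z u) := by
    rw [map_sub, map_sub T, h1]
    abel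
  rw [h3]
  refine (norm_add_le _ _).trans (add_le_add ?_ ?_)
  · exact (norm_sub_pairProj_le x z _).trans (hP.norm_sub_swap_le hν hxy u)
  · rw [hT, Lp.norm_compMeasurePreserving]

end Local

section Cube

variable {X : Type*} [MeasurableSpace X] {m : ℕ} {μ : Measure X} {ξ : X → Fin m → ℝ}
  {ν : ∀ N : ℕ, Kernel (Fin m → ℝ) (Fin N → X)} {ω : Fin m → ℝ} {d N : ℕ}

theorem IsConditionedProduct.isGibbs_cubeLaw (hν : IsConditionedProduct μ ξ ν) (hξ : Measurable ξ)
    (hω : ω ∈ Theta ξ (N ^ d)) : IsGibbs hξ ν (cubeLaw ν d N ω) ω :=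
  (hν.isGibbs hξ (N ^ d) hω).map_equiv hν finFunctionFinEquiv

theorem measurePreserving_cubeLaw (d N : ℕ) (ω : Fin m → ℝ) :
    MeasurePreserving (fun η : Fin (N ^ d) → X => η ∘ finFunctionFinEquiv) (ν (N ^ d) ω)
      (cubeLaw ν d N ω) :=
  ⟨by fun_prop, rfl⟩

/-- The Poincaré inequality on the cube for nearest-neighbour averages, from the mean-field one. -/
theorem mul_norm_sq_le_sum_cubePairs (hξ : Measurable ξ) (hν : IsConditionedProduct μ ξ ν) {δ : ℝ}
    (hmf : ∀ {n : ℕ}, 2 ≤ n → ∀ {ω}, ω ∈ Theta ξ n → ∀ u : Lp ℝ 2 (ν n ω), ∫ η, u η ∂(ν n ω) = 0 →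
      δ * n * ‖u‖ ^ 2 ≤ ∑ b ∈ completePairs n, ‖u - pairProj (ν n ω) b.1 b.2 u‖ ^ 2)
    (hd : 1 ≤ d) (hN : 2 ≤ N) (hω : ω ∈ Theta ξ (N ^ d)) (u : Lp ℝ 2 (cubeLaw ν d N ω))
    (hu : ∫ η, u η ∂(cubeLaw ν d N ω) = 0) :
    δ / (8 * d) * ‖u‖ ^ 2 ≤
      (N : ℝ) ^ 2 * ∑ b ∈ cubePairs d N, ‖u - pairProj (cubeLaw ν d N ω) b.1 b.2 u‖ ^ 2 := by
  have hP := hν.isGibbs hξ (N ^ d) hω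
  have hP' := hν.isGibbs_cubeLaw hξ hω
  have hτ := measurePreserving_cubeLaw (ν := ν) d N ω
  have hn : 2 ≤ N ^ d := hN.trans (Nat.le_self_pow (by omega) N)
  set v := Lp.compMeasurePreserving (E := ℝ) (p := 2) _ hτ u with hv
  have hv0 : ∫ η, v η ∂(ν (N ^ d) ω) = 0 := by
    rw [integral_congr_ae (Lp.coeFn_compMeasurePreserving u hτ)]
    have h1 := integral_map (f := u) hτ.measurable.aemeasurable
      (by rw [hτ.map_eq]; exact (Lp.stronglyMeasurable u).aestronglyMeasurable)
    rw [hτ.map_eq, hu] at h1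
    exact h1.symm
  have h1 := hmf hn hω v hv0
  have h2 : ∑ b ∈ completePairs (N ^ d), ‖v - pairProj (ν (N ^ d) ω) b.1 b.2 v‖ ^ 2 =
      ∑ b ∈ completePairs (N ^ d), pairDist v b.1 b.2 ^ 2 := by
    refine Finset.sum_congr rfl fun b hb => ?_
    rw [pairDist_of_ne v (Finset.mem_filter.1 hb).2.ne]
  have h3 := sum_sum_eq_two_mul_sum_completePairs (F := fun i j => pairDist v i j ^ 2)
    (fun i => by simp [pairDist_self]) (fun i j => by rw [hP.pairDist_symm hν])
  have h4 : ∀ x y, pairDist v (finFunctionFinEquiv x) (finFunctionFinEquiv y) = pairDist u x y := by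
    intro x y
    by_cases hxy : x = y
    · rw [hxy, pairDist_self, pairDist_self]
    · have hxy' := finFunctionFinEquiv.injective.ne hxy
      rw [pairDist_of_ne _ hxy, pairDist_of_ne _ hxy', hv,
        hP.pairProj_compMeasurePreserving hP' hν finFunctionFinEquiv hτ hxy',
        Equiv.symm_apply_apply, Equiv.symm_apply_apply, ← map_sub, Lp.norm_compMeasurePreserving]
  rw [← Equiv.sum_comp finFunctionFinEquiv] at h3
  simp_rw [← Equiv.sum_comp finFunctionFinEquiv fun j => pairDist v _ j ^ 2, h4] at h3
  have h5 := sum_sum_sq_le_sum_cubePairs (pairDist_nonneg u) (pairDist_self u)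
    (hP'.pairDist_symm hν u) (hP'.pairDist_triangle hν u)
  have h6 : ∑ b ∈ cubePairs d N, pairDist u b.1 b.2 ^ 2 ≤
      ∑ b ∈ cubePairs d N, ‖u - pairProj (cubeLaw ν d N ω) b.1 b.2 u‖ ^ 2 := by
    refine Finset.sum_le_sum fun b _ => ?_
    unfold pairDist
    split_ifs
    · rw [zero_pow two_ne_zero]
      positivity
    · exact le_rfl
  have hvn : ‖v‖ = ‖u‖ := Lp.norm_compMeasurePreserving u hτ
  rw [h2, hvn] at h1
  push_cast at h1
  set E := ∑ b ∈ cubePairs d N, ‖u - pairProj (cubeLaw ν d N ω) b.1 b.2 u‖ ^ 2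
  have hd' : (0 : ℝ) < d := by exact_mod_cast hd
  have hN' : (0 : ℝ) < (N : ℝ) ^ d := by
    have : (0 : ℝ) < N := by exact_mod_cast (by omega : 0 < N)
    positivity
  have h7 : 2 * (δ * (N : ℝ) ^ d * ‖u‖ ^ 2) ≤ 16 * d * (N : ℝ) ^ (d + 2) * E :=
    calc 2 * (δ * (N : ℝ) ^ d * ‖u‖ ^ 2) ≤ _ := by rw [h3]; linarith
      _ ≤ 16 * d * (N : ℝ) ^ (d + 2) * ∑ b ∈ cubePairs d N, pairDist u b.1 b.2 ^ 2 := h5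
      _ ≤ _ := by gcongr
  have h8 : (N : ℝ) ^ d * (δ * ‖u‖ ^ 2) ≤ (N : ℝ) ^ d * (8 * d * ((N : ℝ) ^ 2 * E)) := by
    rw [pow_add] at h7
    linarith
  have h9 := le_of_mul_le_mul_left h8 hN'
  rw [div_mul_eq_mul_div, div_le_iff₀ (by positivity)]
  linarith

end Cube

/-! ### Binary collision processes -/

section Collision

theorem mul_integral_sq_le_of_le_gap {Ω : Type*} [MeasurableSpace Ω] {P : Measure Ω}
    {G : (Ω → ℝ) → (Ω → ℝ) → Prop} {c : ℝ} (h : (c : EReal) ≤ gap P G) {f g : Ω → ℝ}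
    (hf : MemLp f 2 P) (hfg : G f g) (hm : ∫ η, f η ∂P = 0) (h0 : ∫ η, f η ^ 2 ∂P ≠ 0) :
    c * ∫ η, f η ^ 2 ∂P ≤ ∫ η, f η * -g η ∂P := by
  have h1 := h.trans ((iInf_le _ f).trans ((iInf_le _ g).trans ((iInf_le _ hf).trans
    ((iInf_le _ hfg).trans ((iInf_le _ hm).trans (iInf_le _ h0))))))
  have hpos : 0 < ∫ η, f η ^ 2 ∂P :=
    lt_of_le_of_ne (integral_nonneg fun η => sq_nonneg _) h0.symm
  rwa [EReal.coe_le_coe_iff, le_div_iff₀ hpos] at h1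

variable {X : Type*} {m : ℕ} {ι : Type*}

theorem slice_eq [DecidableEq ι] {i j : ι} (h : i ≠ j) (η : ι → X) (f : (ι → X) → ℝ)
    (ζ : Fin 2 → X) :
    slice i j η f ζ = f (Function.extend (pairEmb h) ζ η) := by
  unfold slice
  congr 1
  funext l
  by_cases hj : l = j
  · subst hj
    rw [Function.update_self]
    exact ((pairEmb h).injective.extend_apply ζ η 1).symm
  · rw [Function.update_of_ne hj]
    by_cases hi : l = i
    · subst hi
      rw [Function.update_self]
      exact ((pairEmb h).injective.extend_apply ζ η 0).symm
    · rw [Function.update_of_ne hi, Function.extend_apply']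
      rintro ⟨a, ha⟩
      fin_cases a
      · exact hi ha.symm
      · exact hj ha.symm

theorem blockSum_pairEmb (ξ : X → Fin m → ℝ) {i j : ι} (h : i ≠ j) (η : ι → X) :
    blockSum ξ (pairEmb h) η = ξ (η i) + ξ (η j) := by
  rw [blockSum, Fin.sum_univ_two]
  rfl

variable [DecidableEq ι] [MeasurableSpace X] {μ : Measure X} {ξ : X → Fin m → ℝ} {hξ : Measurable ξ}
  {ν : ∀ N : ℕ, Kernel (Fin m → ℝ) (Fin N → X)}
  {L₀ : ∀ ω : Fin m → ℝ, Lp ℝ 2 (ν 2 ω) →ₗ.[ℝ] Lp ℝ 2 (ν 2 ω)} {c : ℝ}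

/-- The two-site Poincaré inequality for `L₀`. -/
theorem IsTwoSiteGenerator.two_mul_norm_centered_sq_le (hL₀ : IsTwoSiteGenerator ξ ν L₀)
    (hν : IsConditionedProduct μ ξ ν) {ω : Fin m → ℝ} (hω : ω ∈ Theta ξ 2)
    (hc : (c : EReal) ≤ gapColl ξ ν L₀ 2 ω) (u : (L₀ ω).domain)
    [IsProbabilityMeasure (ν 2 ω)] :
    2 * c * ‖centered (u : Lp ℝ 2 (ν 2 ω))‖ ^ 2 ≤
      inner ℝ (u : Lp ℝ 2 (ν 2 ω)) (-(L₀ ω u)) := by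
  set v := centered (u : Lp ℝ 2 (ν 2 ω)) with hv
  by_cases h0 : v = 0
  · rw [h0]
    simpa using hL₀.nonneg ω hω u
  let k : Lp ℝ 2 (ν 2 ω) := Lp.const 2 (ν 2 ω) (∫ η, (u : Lp ℝ 2 (ν 2 ω)) η ∂(ν 2 ω))
  obtain ⟨hk, hk0⟩ := hL₀.const ω hω k _ (Lp.coeFn_const (p := 2) _ _)
  have hvmem : v ∈ (L₀ ω).domain := (L₀ ω).domain.sub_mem u.2 hk
  have hLv : L₀ ω ⟨v, hvmem⟩ = L₀ ω u := by
    have h1 : (⟨v, hvmem⟩ : (L₀ ω).domain) = u - ⟨k, hk⟩ := rfl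
    rw [h1, LinearPMap.map_sub, hk0, sub_zero]
  have horth : inner ℝ k (L₀ ω u) = 0 := by
    have hadj : (L₀ ω).adjoint = L₀ ω := hL₀.selfAdjoint ω hω
    have h1 := LinearPMap.adjoint_isFormalAdjoint (hL₀.dense ω hω)
    rw [hadj] at h1
    have h2 := h1 ⟨k, hk⟩ u
    rw [hk0, inner_zero_left] at h2
    exact h2.symm
  have hnorm := Lp_norm_sq_eq_integral (u := v) (.refl _ _)
  have hpos : 0 < ‖v‖ ^ 2 := by positivity
  have hgen : IsCollisionGen ξ ν L₀ (ν 2 ω) (completePairs 2) (1 / ((2 : ℕ) : ℝ)) v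
      (fun η => (1 / ((2 : ℕ) : ℝ)) * ∑ _b ∈ completePairs 2, L₀ ω u η) := by
    refine ⟨fun _ => L₀ ω u, fun b hb => ⟨Lp.memLp _, ?_⟩, rfl⟩
    rw [completePairs_two, Finset.mem_singleton] at hb
    subst hb
    have hs : ∀ (η : Fin 2 → X) (f : (Fin 2 → X) → ℝ), slice 0 1 η f = f := fun η f => by
      funext ζ
      unfold slice
      congr 1
      funext a
      fin_cases a <;> simp
    unfold IsPairGen
    filter_upwards [hν.support 2 ω hω] with η hη
    rw [Fin.sum_univ_two] at hη
    simp only [hs]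
    rw [hη]
    exact ⟨⟨v, hvmem⟩, .refl _ _, by rw [hLv]⟩
  have h1 := mul_integral_sq_le_of_le_gap hc (Lp.memLp v) hgen (integral_centered _)
    (by rw [← hnorm]; exact hpos.ne')
  rw [← hnorm] at h1
  have h2 : ∫ η, v η * -((1 / ((2 : ℕ) : ℝ)) * ∑ _b ∈ completePairs 2, L₀ ω u η) ∂(ν 2 ω) =
      1 / 2 * inner ℝ v (-(L₀ ω u)) := by
    rw [Lp_inner_eq_integral (.refl _ _) (Lp.coeFn_neg _), ← integral_const_mul]
    refine integral_congr_ae (ae_of_all _ fun η => ?_)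
    simp only [completePairs_two, Finset.sum_singleton, Pi.neg_apply]
    push_cast
    ring
  have h3 : inner ℝ v (-(L₀ ω u)) = inner ℝ (u : Lp ℝ 2 (ν 2 ω)) (-(L₀ ω u)) := by
    have : v = (u : Lp ℝ 2 (ν 2 ω)) - k := rfl
    rw [this, inner_sub_left, inner_neg_right k, horth]
    ring
  rw [h2, h3] at h1
  linarith

variable [Fintype ι] {P : Measure (ι → X)} {ω : Fin m → ℝ}

/-- The Dirichlet form of a pair collision dominates that of the pair average, by the two-site
Poincaré inequality conditionally on the variables outside the pair. -/
theorem IsGibbs.two_mul_norm_sub_pairProj_sq_le (hP : IsGibbs hξ ν P ω)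
    (hν : IsConditionedProduct μ ξ ν) (hL₀ : IsTwoSiteGenerator ξ ν L₀)
    (hc : ∀ ω ∈ Theta ξ 2, (c : EReal) ≤ gapColl ξ ν L₀ 2 ω) {i j : ι} (hij : i ≠ j)
    {f h : (ι → X) → ℝ} (hf : MemLp f 2 P) (hh : MemLp h 2 P)
    (hgen : IsPairGen ξ ν L₀ P i j f h) :
    2 * c * ‖hf.toLp - pairProj P i j hf.toLp‖ ^ 2 ≤ ∫ η, f η * -h η ∂P := by
  have := hP.prob
  set e := pairEmb hij with he
  set u := hf.toLp with hu
  set w := hh.toLp with hw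
  have hum : Measurable (u : (ι → X) → ℝ) := (Lp.stronglyMeasurable u).measurable
  have hwm : Measurable (w : (ι → X) → ℝ) := (Lp.stronglyMeasurable w).measurable
  have hKm := measurable_blockAvg hξ hν e hum
  have hD := hP.sub_pairProj_ae_eq hν hij u
  have hDL := (memLp_congr_ae hD).1 (Lp.memLp _)
  have hi1 : Integrable (fun η => u η * -w η) P := (Lp.memLp u).integrable_mul (Lp.memLp w).neg
  have hi2 : Integrable (fun η => 2 * c * (u η - blockAvg ξ ν e u η) ^ 2) P :=
    hDL.integrable_sq.const_mul _
  have hi : Integrable (fun η => u η * -w η - 2 * c * (u η - blockAvg ξ ν e u η) ^ 2) P :=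
    hi1.sub hi2
  have h1 : ∫ η, f η * -h η ∂P = ∫ η, u η * -w η ∂P := by
    refine integral_congr_ae ?_
    filter_upwards [hf.coeFn_toLp, hh.coeFn_toLp] with η e1 e2
    rw [hu, hw, e1, e2]
  rw [h1, Lp_norm_sq_eq_integral hD, ← integral_const_mul, ← sub_nonneg, ← integral_sub hi1 hi2,
    ← hP.integral_eq hν e (by fun_prop) hi]
  refine integral_nonneg_of_ae ?_
  unfold IsPairGen at hgen
  filter_upwards [hgen, hP.ae_ae hν e hf.coeFn_toLp, hP.ae_ae hν e hh.coeFn_toLp] with η hη hfη hhη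
  rw [← blockSum_pairEmb ξ hij] at hη
  obtain ⟨v, hv1, hv2⟩ := hη
  have hΘ := blockSum_mem_Theta ξ e η
  have := hν.isProbabilityMeasure_blockSum e η
  have hv1' : (v : Lp ℝ 2 (ν 2 (blockSum ξ e η))) =ᵐ[ν 2 (blockSum ξ e η)]
      fun ζ => u (Function.extend e ζ η) := by
    filter_upwards [hv1, hfη] with ζ e1 e2
    rw [e1, slice_eq hij, e2]
  have hv2' : L₀ _ v =ᵐ[ν 2 (blockSum ξ e η)] fun ζ => w (Function.extend e ζ η) := by
    filter_upwards [hv2, hhη] with ζ e1 e2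
    rw [e1, slice_eq hij, e2]
  have key := hL₀.two_mul_norm_centered_sq_le hν hΘ (hc _ hΘ) v
  have hmean : ∫ ζ, (v : Lp ℝ 2 (ν 2 (blockSum ξ e η))) ζ ∂(ν 2 (blockSum ξ e η)) =
      blockAvg ξ ν e u η := integral_congr_ae hv1'
  have hcent : centered (v : Lp ℝ 2 (ν 2 (blockSum ξ e η))) =ᵐ[ν 2 (blockSum ξ e η)]
      fun ζ => u (Function.extend e ζ η) - blockAvg ξ ν e u (Function.extend e ζ η) := by
    filter_upwards [hv1', Lp.coeFn_sub (v : Lp ℝ 2 (ν 2 (blockSum ξ e η)))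
      (Lp.const 2 _ (blockAvg ξ ν e u η)), Lp.coeFn_const (p := 2) (ν 2 (blockSum ξ e η))
      (blockAvg ξ ν e u η), ae_sum_eq_blockSum hν e η] with ζ e1 e2 e3 e4
    rw [centered, hmean, e2, Pi.sub_apply, e1, e3, blockAvg_extend e u η e4]
    rfl
  have hneg : (-(L₀ _ v) : Lp ℝ 2 (ν 2 (blockSum ξ e η))) =ᵐ[ν 2 (blockSum ξ e η)]
      fun ζ => -w (Function.extend e ζ η) := by
    filter_upwards [hv2', Lp.coeFn_neg (L₀ _ v)] with ζ e1 e2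
    rw [e2, Pi.neg_apply, e1]
  have hI1 : Integrable (fun ζ => u (Function.extend e ζ η) * -w (Function.extend e ζ η))
      (ν 2 (blockSum ξ e η)) :=
    ((memLp_congr_ae hv1').1 (Lp.memLp _)).integrable_mul ((memLp_congr_ae hneg).1 (Lp.memLp _))
  have hI2 := (((memLp_congr_ae hcent).1 (Lp.memLp _)).integrable_sq).const_mul (2 * c)
  rw [Lp_norm_sq_eq_integral hcent, Lp_inner_eq_integral hv1' hneg, ← sub_nonneg,
    ← integral_const_mul, ← integral_sub hI1 hI2] at key
  exact key

/-- A Poincaré inequality for pair averages bounds from below the gap of the collision process. -/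
theorem IsGibbs.le_gap_isCollisionGen (hP : IsGibbs hξ ν P ω)
    (hν : IsConditionedProduct μ ξ ν) (hL₀ : IsTwoSiteGenerator ξ ν L₀) (hc0 : 0 ≤ c)
    (hc : ∀ ω ∈ Theta ξ 2, (c : EReal) ≤ gapColl ξ ν L₀ 2 ω) {B : Finset (ι × ι)}
    (hB : ∀ b ∈ B, b.1 ≠ b.2) {a C : ℝ} (ha : 0 ≤ a)
    (hC : ∀ u : Lp ℝ 2 P, ∫ η, u η ∂P = 0 →
      C * ‖u‖ ^ 2 ≤ a * ∑ b ∈ B, ‖u - pairProj P b.1 b.2 u‖ ^ 2) :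
    ((2 * c * C : ℝ) : EReal) ≤ gap P (IsCollisionGen ξ ν L₀ P B a) := by
  refine le_iInf fun f => le_iInf fun g => le_iInf fun hf => le_iInf fun hg => le_iInf fun hm =>
    le_iInf fun h0 => ?_
  obtain ⟨h, hh, rfl⟩ := hg
  have hn := Lp_norm_sq_eq_integral hf.coeFn_toLp
  have hpos : 0 < ∫ η, f η ^ 2 ∂P :=
    lt_of_le_of_ne (integral_nonneg fun η => sq_nonneg _) h0.symm
  rw [EReal.coe_le_coe_iff, le_div_iff₀ hpos, ← hn]
  have h1 : ∫ η, f η * -(a * ∑ b ∈ B, h b η) ∂P = a * ∑ b ∈ B, ∫ η, f η * -h b η ∂P := by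
    have hi : ∀ b ∈ B, Integrable (fun η => f η * -h b η) P := fun b hb =>
      hf.integrable_mul (hh b hb).1.neg
    rw [← integral_finsetSum B hi, ← integral_const_mul]
    refine integral_congr_ae (ae_of_all _ fun η => ?_)
    simp only [← Finset.mul_sum, Finset.sum_neg_distrib]
    ring
  rw [h1]
  calc 2 * c * C * ‖hf.toLp‖ ^ 2 = 2 * c * (C * ‖hf.toLp‖ ^ 2) := by ring
    _ ≤ 2 * c * (a * ∑ b ∈ B, ‖hf.toLp - pairProj P b.1 b.2 hf.toLp‖ ^ 2) := by
        refine mul_le_mul_of_nonneg_left (hC _ ?_) (by positivity)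
        rw [integral_congr_ae hf.coeFn_toLp, hm]
    _ = a * ∑ b ∈ B, 2 * c * ‖hf.toLp - pairProj P b.1 b.2 hf.toLp‖ ^ 2 := by
        rw [← Finset.mul_sum]; ring
    _ ≤ _ := by
        refine mul_le_mul_of_nonneg_left (Finset.sum_le_sum fun b hb => ?_) ha
        exact hP.two_mul_norm_sub_pairProj_sq_le hν hL₀ hc (hB b hb) hf (hh b hb).1 (hh b hb).2

theorem ne_of_mem_cubePairs {d N : ℕ} {b : (Fin d → Fin N) × (Fin d → Fin N)}
    (hb : b ∈ cubePairs d N) : b.1 ≠ b.2 := by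
  intro h
  simp [cubePairs, h] at hb

theorem le_sq_mul_of_div_sq_le {N : ℕ} (hN : 2 ≤ N) {r : ℝ} {x : EReal}
    (h : ((r / (N : ℝ) ^ 2 : ℝ) : EReal) ≤ x) : (r : EReal) ≤ (((N : ℝ) ^ 2 : ℝ) : EReal) * x := by
  have hN' : (0 : ℝ) < (N : ℝ) ^ 2 := by
    have : (0 : ℝ) < N := by exact_mod_cast (by omega : 0 < N)
    positivity
  calc (r : EReal) = (((N : ℝ) ^ 2 : ℝ) : EReal) * ((r / (N : ℝ) ^ 2 : ℝ) : EReal) := by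
        rw [← EReal.coe_mul, mul_div_cancel₀ _ hN'.ne']
    _ ≤ _ := mul_le_mul_of_nonneg_left h (EReal.coe_nonneg.2 hN'.le)

end Collision

end

end BinaryCollision

theorem mainTheorem6 {X : Type*} [MeasurableSpace X] (μ : MeasureTheory.Measure X)
    [MeasureTheory.IsProbabilityMeasure μ] {m : ℕ} (ξ : X → Fin m → ℝ) (hξ : Measurable ξ)
    (ν : ∀ N : ℕ, ProbabilityTheory.Kernel (Fin m → ℝ) (Fin N → X))
    (hν : BinaryCollision.IsConditionedProduct μ ξ ν)
    (hErg : ∀ N : ℕ, 4 ≤ N → ∀ ω ∈ BinaryCollision.Theta ξ N, BinaryCollision.IsErgodicAvg ν N ω)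
    (L₀ : ∀ ω : Fin m → ℝ,
      MeasureTheory.Lp ℝ 2 (ν 2 ω) →ₗ.[ℝ] MeasureTheory.Lp ℝ 2 (ν 2 ω))
    (hL₀ : BinaryCollision.IsTwoSiteGenerator ξ ν L₀)
    (d : ℕ) (hd : 1 ≤ d)
    (h3 : (((1 : ℝ) / 3 : ℝ) : EReal) <
      ⨅ ω ∈ BinaryCollision.Theta ξ 3, BinaryCollision.gapAvg ν 3 ω)
    (h2 : 0 < ⨅ ω ∈ BinaryCollision.Theta ξ 2, BinaryCollision.gapColl ξ ν L₀ 2 ω) :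
    (0 < ⨅ (N : ℕ) (_ : 2 ≤ N), ⨅ ω ∈ BinaryCollision.Theta ξ N,
      BinaryCollision.gapAvg ν N ω) ∧
    (0 < ⨅ (N : ℕ) (_ : 2 ≤ N), ⨅ ω ∈ BinaryCollision.Theta ξ (N ^ d),
      (((N : ℝ) ^ 2 : ℝ) : EReal) * BinaryCollision.gapAvgLoc ν d N ω) ∧
    (0 < ⨅ (N : ℕ) (_ : 2 ≤ N), ⨅ ω ∈ BinaryCollision.Theta ξ N,
      BinaryCollision.gapColl ξ ν L₀ N ω) ∧
    (0 < ⨅ (N : ℕ) (_ : 2 ≤ N), ⨅ ω ∈ BinaryCollision.Theta ξ (N ^ d),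
      (((N : ℝ) ^ 2 : ℝ) : EReal) * BinaryCollision.gapCollLoc ξ ν L₀ d N ω) := by
  obtain ⟨r, hr1, hr2⟩ := EReal.lt_iff_exists_real_btwn.1 h3
  obtain ⟨c, hc1, hc2⟩ := EReal.lt_iff_exists_real_btwn.1 h2
  have hr : 1 / 3 < r := EReal.coe_lt_coe_iff.1 hr1
  have hc : 0 < c := EReal.coe_pos.1 hc1
  have hgap3 : ∀ ω ∈ BinaryCollision.Theta ξ 3,
      ((3 * r / 3 : ℝ) : EReal) ≤ BinaryCollision.gapAvg ν 3 ω := fun ω hω => by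
    rw [mul_div_cancel_left₀ r three_ne_zero]
    exact hr2.le.trans (iInf₂_le ω hω)
  have hgap2 : ∀ ω ∈ BinaryCollision.Theta ξ 2,
      (c : EReal) ≤ BinaryCollision.gapColl ξ ν L₀ 2 ω := fun ω hω =>
    hc2.le.trans (iInf₂_le ω hω)
  set δ := min (3 * r - 1) (1 / 2) with hδ
  have hδ0 : 0 < δ := lt_min (by linarith) (by norm_num)
  have hmf : ∀ {n : ℕ}, 2 ≤ n → ∀ {ω}, ω ∈ BinaryCollision.Theta ξ n → ∀ u : Lp ℝ 2 (ν n ω),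
      ∫ η, u η ∂(ν n ω) = 0 → δ * n * ‖u‖ ^ 2 ≤ ∑ b ∈ BinaryCollision.completePairs n,
        ‖u - BinaryCollision.pairProj (ν n ω) b.1 b.2 u‖ ^ 2 := fun hn ω hω =>
    BinaryCollision.mul_norm_sq_le_sum_completePairs hξ hν (min_le_left _ _) hδ0
      (min_le_right _ _) hgap3 hErg hn hω
  have hcomplete : ∀ {N : ℕ}, 2 ≤ N → ∀ {ω}, ω ∈ BinaryCollision.Theta ξ N →
      ∀ u : Lp ℝ 2 (ν N ω), ∫ η, u η ∂(ν N ω) = 0 → δ * ‖u‖ ^ 2 ≤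
        1 / (N : ℝ) * ∑ b ∈ BinaryCollision.completePairs N,
          ‖u - BinaryCollision.pairProj (ν N ω) b.1 b.2 u‖ ^ 2 := fun {N} hN ω hω u hu => by
    have hN' : (0 : ℝ) < N := by exact_mod_cast (by omega : 0 < N)
    have h := hmf hN hω u hu
    rw [one_div, inv_mul_eq_div, le_div_iff₀ hN']
    linarith
  have hd' : (0 : ℝ) < d := by exact_mod_cast hd
  have hcube : ∀ {N : ℕ}, 2 ≤ N → ∀ {ω}, ω ∈ BinaryCollision.Theta ξ (N ^ d) →
      ∀ u : Lp ℝ 2 (BinaryCollision.cubeLaw ν d N ω),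
        ∫ η, u η ∂(BinaryCollision.cubeLaw ν d N ω) = 0 →
        δ / (8 * d) / (N : ℝ) ^ 2 * ‖u‖ ^ 2 ≤ 1 * ∑ b ∈ BinaryCollision.cubePairs d N,
          ‖u - BinaryCollision.pairProj (BinaryCollision.cubeLaw ν d N ω) b.1 b.2 u‖ ^ 2 :=
      fun {N} hN ω hω u hu => by
    have hN' : (0 : ℝ) < N := by exact_mod_cast (by omega : 0 < N)
    have h := BinaryCollision.mul_norm_sq_le_sum_cubePairs hξ hν hmf hd hN hω u hu
    rw [one_mul, div_mul_eq_mul_div, div_le_iff₀ (by positivity)]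
    linarith
  refine ⟨?_, ?_, ?_, ?_⟩
  · refine (EReal.coe_pos.2 hδ0).trans_le
      (le_iInf₂ fun N hN => le_iInf₂ fun ω hω => ?_)
    have := (hν.isGibbs hξ N hω).prob
    exact (BinaryCollision.le_gap_isAverageGen_iff _ _ _).2 (hcomplete hN hω)
  · refine (EReal.coe_pos.2 (by positivity : 0 < δ / (8 * d))).trans_le
      (le_iInf₂ fun N hN => le_iInf₂ fun ω hω => ?_)
    have := (hν.isGibbs_cubeLaw hξ hω).prob
    exact BinaryCollision.le_sq_mul_of_div_sq_le hN
      ((BinaryCollision.le_gap_isAverageGen_iff _ _ _).2 (hcube hN hω))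
  · refine (EReal.coe_pos.2 (by positivity : 0 < 2 * c * δ)).trans_le
      (le_iInf₂ fun N hN => le_iInf₂ fun ω hω => ?_)
    exact (hν.isGibbs hξ N hω).le_gap_isCollisionGen hν hL₀ hc.le hgap2
      (fun b hb => (Finset.mem_filter.1 hb).2.ne) (by positivity) (hcomplete hN hω)
  · refine (EReal.coe_pos.2 (by positivity : 0 < 2 * c * (δ / (8 * d)))).trans_le
      (le_iInf₂ fun N hN => le_iInf₂ fun ω hω => ?_)
    refine BinaryCollision.le_sq_mul_of_div_sq_le hN ?_
    rw [mul_div_assoc]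
    exact (hν.isGibbs_cubeLaw hξ hω).le_gap_isCollisionGen hν hL₀ hc.le hgap2
      (fun b hb => BinaryCollision.ne_of_mem_cubePairs hb) zero_le_one (hcube hN hω)
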